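/- Call a group $G$ capable if $G\cong H/Z(H)$ for some group $H$. Write $[x,y]=x^{-1}y^{-1}xy$, $[x,y,z]=[[x,y],z]$, and let $K_1=K$, $K_{k+1}=[K_k,K]$ be the lower central series of a group $K$. Let $p$ be an odd prime and $G$ a noncyclic group of exponent $p$ and nilpotency class at most $2$. Let $g_1,\dots,g_n\in G$ project onto an $\mathbb{F}_p$-basis of $G^{\mathrm{ab}}$. Let $P$ be the free product of $n$ cyclic groups of order $p$ with generators $x_1,\dots,x_n$, let $F=P/P_4$ (the $3$-nilpotent product), let $C=\langle [x_j,x_i] : 1\le i<j\le n\rangle\le F$, and let $\psi\colon F\to G$ be the homomorphism with $\psi(x_i)=g_i$. Let $U$ be an $\mathbb{F}_p$-vector space with basis $u_1,\dots,u_n$, let $V=\Lambda^2U$ and $W=(V\otimes U)/J$, where $J$ is spanned by all $(a\wedge b)\otimes c+(b\wedge c)\otimes a+(c\wedge a)\otimes b$ with $a,b,c\in U$. For $u\in U$ let $\varphi_u\colon V\to W$ send $v$ to the class of $v\otimes u$. For subspaces $X\le V$ and $Y\le W$ put $X^*=\operatorname{span}\bigl(\varphi_u(X): u\in U\bigr)$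 and $Y^*=\bigcap_{u\in U}\varphi_u^{-1}(Y)$, and call $X$ closed if $X=X^{**}$. Then: (1) there is a unique isomorphism $V\oplus W\cong F_2$ sending $u_j\wedge u_i$ to $[x_j,x_i]$ and $\varphi_{u_k}(u_j\wedge u_i)$ to $[x_j,x_i,x_k]$ for all $i,j,k$; (2) there is a unique subgroup $X$ of $C$ such that $\ker\psi=X\oplus F_3$; (3) viewing $X$ as a subspace of $V$ through the identification in (1), $G$ is capable if and only if $X$ is closed. -/

import Mathlib

open scoped TensorProduct

namespace CapableGroups

/-! ### Groups -/

/-- A group `G` is capable if it is isomorphic to `H / Z(H)` for some group `H`.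
(Letting `H` range over the universe of `G` is no restriction: in any witness, the subgroup generated
by representatives of the cosets of the centre is again a witness, and it is small.) -/
def IsCapable.{u} (G : Type u) [Group G] : Prop :=
  ∃ (H : Type u) (_ : Group H), Nonempty (G ≃* H ⧸ Subgroup.center H)

/-- The `k`-th term `G_k` of the lower central series, for `k ≥ 1`: `G_1 = G` and
`G_{k+1} = [G_k, G]`. -/
abbrev lowerCentral (k : ℕ) (G : Type*) [Group G] : Subgroup G :=
  (⊤ : Subgroup G).lowerCentralSeries (k - 1)

/-- The commutator `[x, y] = x⁻¹ y⁻¹ x y`. -/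
def comm {G : Type*} [Group G] (x y : G) : G := x⁻¹ * y⁻¹ * x * y

/-- The `k`-nilpotent product of a family of groups: the free product modulo the `(k+1)`-st term of
its lower central series. -/
abbrev NilpotentProduct {ι : Type*} (k : ℕ) (A : ι → Type*) [∀ i, Group (A i)] : Type _ :=
  Monoid.CoprodI A ⧸ lowerCentral (k + 1) (Monoid.CoprodI A)

/-- The universal property of the `k`-nilpotent product: homomorphisms from the factors to a group
of class at most `k` extend to the product. -/
def NilpotentProduct.lift {ι : Type*} {k : ℕ} {A : ι → Type*} [∀ i, Group (A i)]
    {G : Type*} [Group G] (hG : lowerCentral (k + 1) G = ⊥) (f : ∀ i, A i →* G) :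
    NilpotentProduct k A →* G :=
  QuotientGroup.lift _ (Monoid.CoprodI.lift f) (by
    rw [← Subgroup.map_eq_bot_iff, Subgroup.map_lowerCentralSeries, eq_bot_iff, ← hG]
    exact Subgroup.lowerCentralSeries_mono _ le_top)

/-- The `3`-nilpotent product `F` of `n` cyclic groups of order `p`. -/
abbrev F (p n : ℕ) : Type :=
  NilpotentProduct 3 (fun _ : Fin n => Multiplicative (ZMod p))

/-- The generator `x_i` of the `i`-th cyclic factor of `F`. -/
def gen (p : ℕ) {n : ℕ} (i : Fin n) : F p n :=
  QuotientGroup.mk (Monoid.CoprodI.of (M := fun _ : Fin n => Multiplicative (ZMod p))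
    (i := i) (Multiplicative.ofAdd 1))

/-- The subgroup `C` of `F` generated by the commutators `[x_j, x_i]`, `i < j`. -/
def C (p n : ℕ) : Subgroup (F p n) :=
  Subgroup.closure {c | ∃ i j : Fin n, i < j ∧ c = comm (gen p j) (gen p i)}

/-- The homomorphism from the cyclic group of order `p` that sends the generator to `g`. -/
def cyclicHom {p : ℕ} {G : Type*} [Group G] (g : G) (hg : g ^ p = 1) :
    Multiplicative (ZMod p) →* G :=
  AddMonoidHom.toMultiplicativeLeft
    (ZMod.lift p ⟨zmultiplesHom (Additive G) (Additive.ofMul g), by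
      simp [← ofMul_pow, hg]⟩)

/-- The homomorphism `ψ : F → G` with `x_i ↦ g_i`, for `G` of class at most two and exponent
`p`. -/
def psi {p n : ℕ} {G : Type*} [Group G] (hclass : lowerCentral 3 G = ⊥)
    (hexp : Monoid.exponent G = p) (g : Fin n → G) : F p n →* G :=
  NilpotentProduct.lift (k := 3)
    (eq_bot_iff.2 (((⊤ : Subgroup G).lowerCentralSeries_antitone (by decide : 2 ≤ 3)).trans
      hclass.le))
    (fun i => cyclicHom (g i) (hexp ▸ Monoid.pow_exponent_eq_one (g i)))

theorem psi_gen {p n : ℕ} {G : Type*} [Group G] (hclass : lowerCentral 3 G = ⊥)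
    (hexp : Monoid.exponent G = p) (g : Fin n → G) (i : Fin n) :
    psi hclass hexp g (gen p i) = g i := by
  have h : (1 : ZMod p) = ((1 : ℤ) : ZMod p) := by simp
  simp only [psi, NilpotentProduct.lift, gen, QuotientGroup.lift_mk, Monoid.CoprodI.lift_of,
    cyclicHom, AddMonoidHom.coe_toMultiplicativeLeft, Function.comp, toAdd_ofAdd]
  rw [h, ZMod.lift_coe]
  simp

/-- The abelianization of a group of exponent `p`, as a vector space over `𝔽_p`. -/
abbrev abelianizationModule {p : ℕ} {G : Type*} [Group G] (hexp : Monoid.exponent G = p) :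
    Module (ZMod p) (Additive (Abelianization G)) :=
  AddCommGroup.zmodModule (n := p) (fun x => by
    obtain ⟨y, hy⟩ := QuotientGroup.mk_surjective (Additive.toMul x)
    apply Additive.toMul.injective
    have h : (Abelianization.of y) ^ p = 1 := by
      rw [← map_pow, ← hexp, Monoid.pow_exponent_eq_one, map_one]
    rw [toMul_nsmul]
    change _ = (1 : Abelianization G)
    rw [← h]
    exact congrArg (· ^ p) hy.symm)

/-- The family `a` is a basis of the vector space `A`. -/
def IsBasis (K : Type*) {ι A : Type*} [Semiring K] [AddCommMonoid A] [Module K A] (a : ι → A) :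
    Prop :=
  ∃ b : Module.Basis ι K A, ∀ i, b i = a i

/-- The elements `g_1, …, g_n` of `G` project onto an `𝔽_p`-basis of the abelianization. -/
def ProjectsToBasis {p n : ℕ} {G : Type*} [Group G] (hexp : Monoid.exponent G = p)
    (g : Fin n → G) : Prop :=
  letI := abelianizationModule hexp
  IsBasis (ZMod p) (fun i => Additive.ofMul (Abelianization.of (g i)))

/-! ### The closure operator of a family of linear maps -/

section Star

variable {K V W ι : Type*} [Field K] [AddCommGroup V] [Module K V] [AddCommGroup W] [Module K W]

/-- `X^* = span (ℓ_i(X) | i ∈ I)` for a subspace `X` of `V`. -/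
def upStar (ℓ : ι → V →ₗ[K] W) (X : Submodule K V) : Submodule K W :=
  Submodule.span K (⋃ i, ℓ i '' X)

/-- `Y^* = ⋂ i, ℓ_i⁻¹(Y)` for a subspace `Y` of `W`. -/
def downStar (ℓ : ι → V →ₗ[K] W) (Y : Submodule K W) : Submodule K V :=
  ⨅ i, Y.comap (ℓ i)

/-- `X` is `{ℓ_i}`-closed: `X = X^{**}`. -/
def IsClosedFor (ℓ : ι → V →ₗ[K] W) (X : Submodule K V) : Prop :=
  X = downStar ℓ (upStar ℓ X)

end Star

/-! ### The spaces `V = U ∧ U` and `W = (V ⊗ U) / J` -/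

section UVW

variable (K : Type*) [Field K] (U : Type*) [AddCommGroup U] [Module K U]

/-- `V = U ∧ U`. -/
def V : Type _ := ⋀[K]^2 U

instance : AddCommGroup (V K U) := inferInstanceAs (AddCommGroup (⋀[K]^2 U))

instance : Module K (V K U) := inferInstanceAs (Module K (⋀[K]^2 U))

variable {U}

/-- The vector `a ∧ b` of `V`. -/
def wedge (a b : U) : V K U := exteriorPower.ιMulti K 2 ![a, b]

variable (U)

/-- The subspace `J` of `V ⊗ U` spanned by all
`(a ∧ b) ⊗ c + (b ∧ c) ⊗ a + (c ∧ a) ⊗ b`. -/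
def J : Submodule K (V K U ⊗[K] U) :=
  Submodule.span K
    {t | ∃ a b c : U, t = wedge K a b ⊗ₜ[K] c + wedge K b c ⊗ₜ[K] a + wedge K c a ⊗ₜ[K] b}

/-- `W = (V ⊗ U) / J`. -/
abbrev W : Type _ := (V K U ⊗[K] U) ⧸ J K U

variable {U}

/-- `φ_u : V → W`, where `φ_u(v)` is the image of `v ⊗ u` in `W`. -/
def phi (u : U) : V K U →ₗ[K] W K U :=
  (J K U).mkQ ∘ₗ (TensorProduct.mk K (V K U) U).flip u

end UVW

/-! ### The identification of `F_2` with `V ⊕ W` -/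

section Identification

variable {p n : ℕ} [Fact p.Prime] {U : Type*} [AddCommGroup U] [Module (ZMod p) U]

/-- An isomorphism `e : V ⊕ W ≃ F_2` is the identification relative to the basis `u_1, …, u_n` of
`U` if it sends `v_{ji} = u_j ∧ u_i` to `[x_j, x_i]` and `w_{jik} = φ_{u_k}(v_{ji})` to
`[x_j, x_i, x_k]`. -/
def IsIdentification (u : Module.Basis (Fin n) (ZMod p) U)
    (e : Multiplicative (V (ZMod p) U × W (ZMod p) U) ≃* lowerCentral 2 (F p n)) : Prop :=
  (∀ j i, (e (Multiplicative.ofAdd (wedge (ZMod p) (u j) (u i), 0)) : F p n)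
    = comm (gen p j) (gen p i)) ∧
  (∀ j i k, (e (Multiplicative.ofAdd (0, phi (ZMod p) (u k) (wedge (ZMod p) (u j) (u i)))) : F p n)
    = comm (comm (gen p j) (gen p i)) (gen p k))

/-- The subspace of `V` that corresponds to a subgroup `X` of `F` under the identification `e`. -/
def toSubspace (e : Multiplicative (V (ZMod p) U × W (ZMod p) U) ≃* lowerCentral 2 (F p n))
    (X : Subgroup (F p n)) : Submodule (ZMod p) (V (ZMod p) U) where
  carrier := {v | (e (Multiplicative.ofAdd (v, 0)) : F p n) ∈ X}
  add_mem' := by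
    intro a b ha hb
    have h : Multiplicative.ofAdd ((a + b, 0) : V (ZMod p) U × W (ZMod p) U)
        = Multiplicative.ofAdd (a, 0) * Multiplicative.ofAdd (b, 0) := by
      rw [← ofAdd_add, Prod.mk_add_mk, add_zero]
    simp only [Set.mem_ofPred_eq] at ha hb ⊢
    rw [h, map_mul]
    exact X.mul_mem ha hb
  zero_mem' := by
    have h : Multiplicative.ofAdd ((0, 0) : V (ZMod p) U × W (ZMod p) U) = 1 := rfl
    simp only [Set.mem_ofPred_eq]
    rw [h, map_one]
    exact X.one_mem
  smul_mem' := by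
    intro c a ha
    have h : Multiplicative.ofAdd ((c • a, 0) : V (ZMod p) U × W (ZMod p) U)
        = Multiplicative.ofAdd (a, 0) ^ c.val := by
      rw [← ofAdd_nsmul, ← Nat.cast_smul_eq_nsmul (ZMod p), ZMod.natCast_zmod_val, Prod.smul_mk,
        smul_zero]
    simp only [Set.mem_ofPred_eq] at ha ⊢
    rw [h, map_pow]
    exact X.pow_mem ha _

/-- `X` is a subgroup of `C` and `N = X ⊕ F_3` (as an internal direct sum; both summands lie in the
abelian group `F_2`). -/
structure IsRelationSubgroup (N X : Subgroup (F p n)) : Prop where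
  le_C : X ≤ C p n
  inf_eq : X ⊓ lowerCentral 3 (F p n) = ⊥
  sup_eq : X ⊔ lowerCentral 3 (F p n) = N

end Identification

end CapableGroups

open scoped commutatorElement

namespace CapableGroups

/-! ### Commutator calculus in groups of class at most three -/

section Calculus

variable {K : Type*} [Group K]

/-! Everything rests on one homomorphism. Let `K` have class at most three and let `x_1, …, x_n` be
elements whose `p`-th powers commute with all `x_j`. As `p` is odd, the `[x_j, x_i]` have order
dividing `p` (`comm_pow_eq_one`), and the derived subgroup is abelian. Antisymmetry and the
Hall–Witt identity then give `θ : V ⊕ W → K` that turns `φ_{u_k}` into commutation with `x_k`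
(`exists_isCommutatorHom`).

For `K = F`, `θ` maps onto `F_2`, with `W` going onto `F_3` and `V` onto `C`. It is injective
because unitriangular matrices separate the images of a basis of `V` and one of `W`
(`injective_of_isCommutatorHom_gen`). This gives (1), and (2) follows with `X = ker ψ ⊓ C`.

For (3), if `X` is closed, put `N = θ(X^*)`. An element central modulo `N` lies in `F_2`, since `n ≥
2` in the nontrivial case, and its `V`-part lies in `X^{**} = X`; so the centre of `F/N` is `ker ψ /
N`. Conversely, if `G ≅ H/Z(H)`, lifts of the `g_i` to `H` have central `p`-th powers and yield `η :
V ⊕ W → H` over `ψ ∘ θ`. Then `η` kills `X^*`, so `η` of `X^{**}` commutes with the lifts, hence is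
central, and `X^{**} ≤ X`. -/

theorem comm_eq_commutatorElement (x y : K) : comm x y = ⁅x⁻¹, y⁻¹⁆ := by
  simp [comm, commutatorElement_def]

theorem map_comm {L : Type*} [Group L] (f : K →* L) (x y : K) :
    f (comm x y) = comm (f x) (f y) := by
  simp [comm]

theorem comm_inv (x y : K) : (comm x y)⁻¹ = comm y x := by
  simp [comm, mul_assoc]

@[simp] theorem comm_one_right (x : K) : comm x 1 = 1 := by simp [comm]

@[simp] theorem comm_one_left (x : K) : comm 1 x = 1 := by simp [comm]

theorem comm_eq_one_iff {x y : K} : comm x y = 1 ↔ Commute x y := by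
  rw [comm_eq_commutatorElement, commutatorElement_eq_one_iff_commute, Commute.inv_inv_iff]

theorem mul_comm_eq (x y : K) : y * x * comm x y = x * y := by
  simp [comm, mul_assoc]

theorem comm_mem_lowerCentral_succ {k : ℕ} {x : K} (hx : x ∈ lowerCentral (k + 1) K) (y : K) :
    comm x y ∈ lowerCentral (k + 2) K := by
  rw [comm_eq_commutatorElement]
  exact Subgroup.commutator_mem_commutator (inv_mem hx) (Subgroup.mem_top _)

theorem comm_mem_lowerCentral_two (x y : K) : comm x y ∈ lowerCentral 2 K :=
  comm_mem_lowerCentral_succ (k := 0) (Subgroup.mem_top x) y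

theorem lowerCentral_three_le_two : lowerCentral 3 K ≤ lowerCentral 2 K :=
  Subgroup.lowerCentralSeries_antitone _ (by decide : 1 ≤ 2)

/-- The three subgroups lemma for `T`, `T`, `⁅T, T⁆`. With `T = ⊤` it makes the derived subgroup of
a group of class three abelian. -/
theorem commutator_commutator_self_eq_bot (T : Subgroup K) (h : ⁅⁅⁅T, T⁆, T⁆, T⁆ = ⊥) :
    ⁅⁅T, T⁆, ⁅T, T⁆⁆ = ⊥ := by
  refine Subgroup.commutator_commutator_eq_bot_of_rotate ?_ h
  rw [Subgroup.commutator_comm T ⁅T, T⁆]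
  exact h

variable (hK : lowerCentral 4 K = ⊥)
include hK

theorem lowerCentral_three_le_center : lowerCentral 3 K ≤ Subgroup.center K :=
  Subgroup.commutator_top_right_eq_bot_iff_le_center.1 hK

theorem commute_of_mem_three {z : K} (hz : z ∈ lowerCentral 3 K) (x : K) : Commute z x :=
  ((Subgroup.mem_center_iff.1 (lowerCentral_three_le_center hK hz)) x).symm

theorem commute_of_mem_two {v w : K} (hv : v ∈ lowerCentral 2 K) (hw : w ∈ lowerCentral 2 K) :
    Commute v w := by
  have h : ⁅lowerCentral 2 K, lowerCentral 2 K⁆ = ⊥ := commutator_commutator_self_eq_bot ⊤ hK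
  rw [Subgroup.commutator_eq_bot_iff_le_centralizer] at h
  exact (Subgroup.mem_centralizer_iff.1 (h hv) w hw).symm

theorem comm_mul_left {v w : K} (hv : v ∈ lowerCentral 2 K) (x : K) :
    comm (v * w) x = comm v x * comm w x := by
  have h := commute_of_mem_three hK (comm_mem_lowerCentral_succ (k := 1) hv x) w
  calc comm (v * w) x = w⁻¹ * (comm v x * w) * comm w x := by simp [comm, mul_assoc]
    _ = _ := by rw [h.eq]; group

theorem comm_mul_right {v : K} (hv : v ∈ lowerCentral 2 K) (x y : K) :
    comm v (x * y) = comm v x * comm v y := by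
  have h := commute_of_mem_three hK (comm_mem_lowerCentral_succ (k := 1) hv x)
  calc comm v (x * y) = comm v y * (y⁻¹ * (comm v x * y)) := by simp [comm, mul_assoc]
    _ = _ := by rw [(h y).eq, (h (comm v y)).eq]; group

/-- For `v` in the derived subgroup of a group of class at most three, `x ↦ [v, x]` is a
homomorphism. -/
def commRightHom {v : K} (hv : v ∈ lowerCentral 2 K) : K →* K where
  toFun := comm v
  map_one' := comm_one_right v
  map_mul' := comm_mul_right hK hv

theorem comm_pow_right {v : K} (hv : v ∈ lowerCentral 2 K) (x : K) (m : ℕ) :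
    comm v (x ^ m) = comm v x ^ m :=
  map_pow (commRightHom hK hv) x m

theorem comm_pow_left {v : K} (hv : v ∈ lowerCentral 2 K) (x : K) (m : ℕ) :
    comm (v ^ m) x = comm v x ^ m := by
  induction m with
  | zero => simp
  | succ m ih => rw [pow_succ, comm_mul_left hK (pow_mem hv m), ih, pow_succ]

theorem comm_inv_left {v : K} (hv : v ∈ lowerCentral 2 K) (x : K) :
    comm v⁻¹ x = (comm v x)⁻¹ := by
  have h := comm_mul_left hK (inv_mem hv) (w := v) x
  rw [inv_mul_cancel, comm_one_left] at h
  exact eq_inv_of_mul_eq_one_left h.symm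

theorem comm_mul_left_of_mem_three {v z : K} (hv : v ∈ lowerCentral 2 K)
    (hz : z ∈ lowerCentral 3 K) (x : K) : comm (v * z) x = comm v x := by
  rw [comm_mul_left hK hv, comm_eq_one_iff.2 (commute_of_mem_three hK hz x), mul_one]

/-- Modulo the central subgroup `K_3`, `[x, y⁻¹]` agrees with `[x, y]⁻¹`. -/
theorem comm_comm_inv_right (x y z : K) : comm (comm x y⁻¹) z = (comm (comm x y) z)⁻¹ := by
  have h : comm x y⁻¹ = (comm x y)⁻¹ * comm (comm x y)⁻¹ y⁻¹ := by simp [comm, mul_assoc]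
  have h2 := inv_mem (comm_mem_lowerCentral_two x y)
  rw [h, comm_mul_left_of_mem_three hK h2 (comm_mem_lowerCentral_succ (k := 1) h2 _),
    comm_inv_left hK (comm_mem_lowerCentral_two x y)]

/-- The Hall–Witt identity in class three. -/
theorem comm_jacobi (x y z : K) :
    comm (comm x y) z * comm (comm y z) x * comm (comm z x) y = 1 := by
  -- This is the Hall–Witt identity of an arbitrary group; in class three the outer conjugations act
  -- trivially and each inner inverse inverts the whole commutator.
  have hw : (y⁻¹ * comm (comm x y⁻¹) z * y) * (z⁻¹ * comm (comm y z⁻¹) x * z) *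
      (x⁻¹ * comm (comm z x⁻¹) y * x) = 1 := by simp [comm, mul_assoc]
  have hc (a b c d : K) : d⁻¹ * comm (comm a b) c * d = comm (comm a b) c := by
    rw [mul_assoc, (commute_of_mem_three hK (comm_mem_lowerCentral_succ (k := 1)
      (comm_mem_lowerCentral_two a b) c) d).eq, inv_mul_cancel_left]
  rw [hc, hc, hc, comm_comm_inv_right hK, comm_comm_inv_right hK, comm_comm_inv_right hK] at hw
  have h3 (a b c : K) := commute_of_mem_three hK (comm_mem_lowerCentral_succ (k := 1)
    (comm_mem_lowerCentral_two a b) c)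
  rw [← mul_inv_rev, ← mul_inv_rev, inv_eq_one] at hw
  rw [(h3 x y z _).eq, ((h3 z x y) _).symm.eq, hw]

/-- Collection: moving `x` left past `[x, y]^m` costs the central factor `[x, y, x]^m`, and these
add up to the binomial coefficient. It serves to expand powers of the conjugate `y⁻¹xy = x[x, y]`.
-/
theorem mul_comm_pow (x y : K) (m : ℕ) :
    (x * comm x y) ^ m = x ^ m * comm x y ^ m * comm (comm x y) x ^ m.choose 2 := by
  have h2 := comm_mem_lowerCentral_two x y
  have h3 := commute_of_mem_three hK (comm_mem_lowerCentral_succ (k := 1) h2 x)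
  induction m with
  | zero => simp
  | succ m ih =>
    rw [pow_succ, ih, Nat.choose_succ_succ' m 1, Nat.choose_one_right, pow_add _ m (m.choose 2),
      mul_assoc, ((h3 _).pow_left _).eq]
    have : comm x y ^ m * x = x * comm x y ^ m * comm (comm x y) x ^ m := by
      rw [← comm_pow_left hK h2, mul_comm_eq]
    calc x ^ m * comm x y ^ m * (x * comm x y * comm (comm x y) x ^ m.choose 2)
        = x ^ m * (comm x y ^ m * x) * comm x y * comm (comm x y) x ^ m.choose 2 := by
          simp only [mul_assoc]
      _ = x ^ (m + 1) * comm x y ^ m * (comm (comm x y) x ^ m * comm x y) *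
          comm (comm x y) x ^ m.choose 2 := by
          rw [this, pow_succ]; simp only [mul_assoc]
      _ = _ := by
          rw [((h3 _).pow_left _).eq, pow_succ (comm x y)]; simp only [mul_assoc]

/-- Conjugation by `y` fixes `x^p`, so `(x[x, y])^p = x^p`. In the expansion, `[x, y, x]^p = [x, y,
x^p] = 1`, and `p` divides `p.choose 2` as `p` is odd. -/
theorem comm_pow_eq_one {p : ℕ} (hp : p.Prime) (hp2 : p ≠ 2) {x y : K}
    (hxy : Commute (x ^ p) y) : comm x y ^ p = 1 := by
  have h2 := comm_mem_lowerCentral_two x y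
  have hx : Commute (x ^ p) x := (Commute.refl x).pow_left p
  have h3 : comm (comm x y) x ^ p = 1 := by
    rw [← comm_pow_right hK h2, comm_eq_one_iff]
    exact (((hx.inv_right.mul_right hxy.inv_right).mul_right hx).mul_right hxy).symm
  have h : (x * comm x y) ^ p = x ^ p := by
    have : x * comm x y = y⁻¹ * x * y⁻¹⁻¹ := by simp [comm, mul_assoc]
    rw [this, conj_pow, inv_inv, mul_assoc, hxy.eq, inv_mul_cancel_left]
  obtain ⟨k, hk⟩ := hp.dvd_choose_self two_ne_zero (lt_of_le_of_ne hp.two_le (Ne.symm hp2))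
  rw [mul_comm_pow hK, hk, pow_mul, h3, one_pow, mul_one] at h
  exact mul_eq_left.1 h

end Calculus

/-! ### Spanning sets of `V` and `W`, and linear maps out of them -/

section Linear

variable {R : Type*} [Field R] {U : Type*} [AddCommGroup U] [Module R U]

theorem wedge_self (a : U) : wedge R a a = 0 :=
  (exteriorPower.ιMulti R 2).map_eq_zero_of_eq ![a, a] (i := 0) (j := 1) (by simp) (by decide)

theorem wedge_swap (a b : U) : wedge R b a = -wedge R a b := by
  have h := (exteriorPower.ιMulti R 2 (M := U)).map_swap ![a, b] (i := 0) (j := 1) (by decide)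
  rw [← show ![b, a] = ![a, b] ∘ Equiv.swap (0 : Fin 2) 1 by ext i; fin_cases i <;> simp] at h
  exact h

theorem update_cons_pair {α : Type*} [DecidableEq (Fin 2)] (a b c : α) :
    Function.update ![a, b] 0 c = ![c, b] := by
  ext i; fin_cases i <;> simp

theorem wedge_add_left (a a' b : U) : wedge R (a + a') b = wedge R a b + wedge R a' b := by
  have h := (exteriorPower.ιMulti R 2 (M := U)).map_update_add ![a, b] 0 a a'
  simp only [update_cons_pair] at h
  exact h

theorem wedge_smul_left (r : R) (a b : U) : wedge R (r • a) b = r • wedge R a b := by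
  have h := (exteriorPower.ιMulti R 2 (M := U)).map_update_smul ![a, b] 0 r a
  simp only [update_cons_pair] at h
  exact h

variable (R U) in
/-- The map `(a, b) ↦ a ∧ b` as a bilinear map. -/
def wedgeBilin : U →ₗ[R] U →ₗ[R] V R U :=
  LinearMap.mk₂ R (wedge R) wedge_add_left wedge_smul_left
    (fun a b b' => by
      rw [wedge_swap, wedge_add_left, wedge_swap a b, wedge_swap a b', neg_add, neg_neg, neg_neg])
    (fun r a b => by rw [wedge_swap, wedge_smul_left, wedge_swap a b, smul_neg, neg_neg])

theorem span_wedge : Submodule.span R (Set.range fun a : U × U => wedge R a.1 a.2) = ⊤ := by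
  have h := exteriorPower.ιMulti_span R 2 U
  rw [eq_top_iff]
  refine (show (⊤ : Submodule R (V R U)) = _ from h.symm).le.trans (Submodule.span_mono ?_)
  rintro _ ⟨a, rfl⟩
  refine ⟨(a 0, a 1), ?_⟩
  change exteriorPower.ιMulti R 2 ![a 0, a 1] = _
  congr 1
  ext i
  fin_cases i <;> rfl

/-- Triples `(j, i, k)` with `i < j` and `i ≤ k`, which index a basis of `W`. -/
abbrev HallTriple (n : ℕ) : Type :=
  {t : Fin n × Fin n × Fin n // t.2.1 < t.1 ∧ t.2.1 ≤ t.2.2}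

variable {n : ℕ} (u : Module.Basis (Fin n) R U)

include u in
-- Spanning is phrased through subspaces so that it applies directly to preimages and equalizers of
-- homomorphisms.
theorem eq_top_of_basis_mem (S : Submodule R U) (hS : ∀ i, u i ∈ S) : S = ⊤ := by
  rw [eq_top_iff, ← u.span_eq, Submodule.span_le]
  exact Set.range_subset_iff.2 hS

theorem eq_top_of_wedge_mem (S : Submodule R (V R U))
    (hS : ∀ i j, i < j → wedge R (u j) (u i) ∈ S) : S = ⊤ := by
  have hb (i j) : wedge R (u j) (u i) ∈ S := by
    rcases lt_trichotomy i j with h | rfl | h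
    · exact hS i j h
    · rw [wedge_self]; exact S.zero_mem
    · rw [wedge_swap]; exact S.neg_mem (hS j i h)
  have h1 (j) : S.comap (wedgeBilin R U (u j)) = ⊤ := eq_top_of_basis_mem u _ fun i => hb i j
  have h2 (b) : S.comap ((wedgeBilin R U).flip b) = ⊤ := eq_top_of_basis_mem u _ fun j => by
    have : b ∈ S.comap (wedgeBilin R U (u j)) := h1 j ▸ Submodule.mem_top
    exact this
  rw [eq_top_iff, ← span_wedge, Submodule.span_le]
  rintro _ ⟨⟨a, b⟩, rfl⟩
  have : a ∈ S.comap ((wedgeBilin R U).flip b) := h2 b ▸ Submodule.mem_top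
  exact this

theorem phi_apply (a : U) (v : V R U) : phi R a v = (J R U).mkQ (v ⊗ₜ a) := rfl

variable (R U) in
/-- The map `(u, v) ↦ φ_u(v)` as a bilinear map. -/
def phiBilin : U →ₗ[R] V R U →ₗ[R] W R U :=
  (TensorProduct.mk R (V R U) U).flip.compr₂ (J R U).mkQ

theorem phi_jacobi (a b c : U) :
    phi R c (wedge R a b) + phi R a (wedge R b c) + phi R b (wedge R c a) = 0 := by
  rw [phi_apply, phi_apply, phi_apply, ← map_add, ← map_add, Submodule.mkQ_apply,
    Submodule.Quotient.mk_eq_zero]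
  exact Submodule.subset_span ⟨a, b, c, rfl⟩

theorem eq_top_of_phi_mem (S : Submodule R (W R U)) (hS : ∀ k v, phi R (u k) v ∈ S) : S = ⊤ := by
  rw [eq_top_iff]
  rintro w -
  obtain ⟨t, rfl⟩ := (J R U).mkQ_surjective w
  induction t with
  | zero => simp
  | add x y hx hy => rw [map_add]; exact S.add_mem hx hy
  | tmul v a =>
    have h : S.comap ((phiBilin R U).flip v) = ⊤ := eq_top_of_basis_mem u _ fun k => hS k v
    have h' : a ∈ S.comap ((phiBilin R U).flip v) := h ▸ Submodule.mem_top
    exact h'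

theorem eq_top_of_hall_mem (S : Submodule R (W R U))
    (hS : ∀ i j k, i < j → i ≤ k → phi R (u k) (wedge R (u j) (u i)) ∈ S) : S = ⊤ := by
  refine eq_top_of_phi_mem u S fun k v => ?_
  have h : S.comap (phi R (u k)) = ⊤ := eq_top_of_wedge_mem u _ fun i j hij => by
    rw [Submodule.mem_comap]
    rcases le_or_gt i k with hik | hik
    · exact hS i j k hij hik
    · have h1 := hS k i j hik (hik.trans hij).le
      have h2 := hS k j i (hik.trans hij) hik.le
      have h := phi_jacobi (R := R) (u j) (u i) (u k)
      rw [wedge_swap (u j) (u k), map_neg, ← sub_eq_add_neg, sub_eq_zero] at h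
      rw [eq_sub_of_add_eq h]
      exact S.sub_mem h2 h1
  have h' : v ∈ S.comap (phi R (u k)) := h ▸ Submodule.mem_top
  exact h'

variable {A : Type*} [AddCommGroup A] [Module R A]

/-- The linear map on `V` induced by an alternating bilinear map. -/
noncomputable def liftWedge (B : U →ₗ[R] U →ₗ[R] A) (hB : ∀ a, B a a = 0) : V R U →ₗ[R] A :=
  exteriorPower.alternatingMapLinearEquiv
    { toFun := fun m => B (m 0) (m 1)
      map_update_add' := fun m i x y => by fin_cases i <;> simp
      map_update_smul' := fun m i r x => by fin_cases i <;> simp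
      map_eq_zero_of_eq' := fun m i j h hij => by
        have h01 : m 0 = m 1 := by
          fin_cases i <;> fin_cases j <;> simp_all
        rw [h01, hB] }

theorem liftWedge_wedge (B : U →ₗ[R] U →ₗ[R] A) (hB : ∀ a, B a a = 0) (a b : U) :
    liftWedge B hB (wedge R a b) = B a b :=
  exteriorPower.alternatingMapLinearEquiv_apply_ιMulti _ _

/-- An antisymmetric family of vectors indexed by pairs defines a linear map on `V`. -/
theorem exists_linearMap_wedge (h2 : (2 : R) ≠ 0) (c : Fin n → Fin n → A)
    (hc : ∀ i j, c j i = -c i j) :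
    ∃ f : V R U →ₗ[R] A, ∀ i j, f (wedge R (u i) (u j)) = c i j := by
  let B : U →ₗ[R] U →ₗ[R] A := u.constr R fun i => u.constr R (c i)
  have hBu (i j) : B (u i) (u j) = c i j := by simp [B]
  have hB' : B.flip = -B := u.ext fun i => u.ext fun j => by
    simp only [LinearMap.flip_apply, LinearMap.neg_apply, hBu]
    exact hc i j
  have hB (a) : B a a = 0 := by
    have h := congrArg (fun f => f a a) hB'
    simp only [LinearMap.flip_apply, LinearMap.neg_apply] at h
    -- Antisymmetry only gives `2 B(a, a) = 0`; characteristic different from two makes `B`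
    -- alternating.
    have h' : (2 : R) • B a a = 0 := by rw [two_smul]; nth_rw 1 [h]; simp
    exact (smul_eq_zero.1 h').resolve_left h2
  exact ⟨liftWedge B hB, fun i j => by rw [liftWedge_wedge, hBu]⟩

/-- A linear map `f` on `V` and endomorphisms `D_k` of the target that satisfy the Jacobi identity
define a linear map on `W`. -/
theorem exists_linearMap_phi (f : V R U →ₗ[R] A) (D : Fin n → A →ₗ[R] A)
    (hD : ∀ i j k, D k (f (wedge R (u i) (u j))) + D i (f (wedge R (u j) (u k)))
      + D j (f (wedge R (u k) (u i))) = 0) :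
    ∃ h : W R U →ₗ[R] A, ∀ k v, h (phi R (u k) v) = D k (f v) := by
  let E : U →ₗ[R] A →ₗ[R] A := u.constr R D
  have hEu (k) : E (u k) = D k := by simp [E]
  let T : U →ₗ[R] U →ₗ[R] U →ₗ[R] A :=
    (wedgeBilin R U).compr₂ ((E.flip).comp f)
  have hT (a b c) : T a b c = E c (f (wedge R a b)) := rfl
  -- The cyclic sum is trilinear: `step` passes from basis vectors to all vectors in the first slot,
  -- and `rot` brings each slot to the front.
  have h0 : ∀ a b c, T a b c + T b c a + T c a b = 0 := by
    have step (b c) (h : ∀ i, T (u i) b c + T b c (u i) + T c (u i) b = 0) (a) :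
        T a b c + T b c a + T c a b = 0 := by
      have : (T.flip b).flip c + T b c + (T c).flip b = 0 := u.ext h
      exact LinearMap.congr_fun this a
    have rot (a b c) (h : T a b c + T b c a + T c a b = 0) :
        T b c a + T c a b + T a b c = 0 := by rw [← h]; abel
    intro a b c
    refine step b c (fun i => rot _ _ _ (rot _ _ _ (step c (u i) (fun j => ?_) b))) a
    refine rot _ _ _ (rot _ _ _ (step (u i) (u j) (fun k => ?_) c))
    simpa only [hT, hEu] using hD k i j
  have hJ : J R U ≤ LinearMap.ker (TensorProduct.lift (E.flip.comp f)) := by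
    rw [J, Submodule.span_le]
    rintro _ ⟨a, b, c, rfl⟩
    rw [SetLike.mem_coe, LinearMap.mem_ker, map_add, map_add]
    exact h0 a b c
  refine ⟨(J R U).liftQ _ hJ, fun k v => ?_⟩
  rw [← hEu]
  rfl

end Linear

/-! ### The homomorphism `V ⊕ W → K` attached to elements of a group `K` of class three -/

section Theta

variable {K : Type*} [Group K]

/-- The elements of the derived subgroup of a group of class at most three that are killed by
`p`. -/
def derivedTorsion (p : ℕ) (hK : lowerCentral 4 K = ⊥) : Subgroup K where
  carrier := {k | k ∈ lowerCentral 2 K ∧ k ^ p = 1}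
  one_mem' := ⟨one_mem _, one_pow p⟩
  mul_mem' := fun ha hb =>
    ⟨mul_mem ha.1 hb.1, by
      rw [(commute_of_mem_two hK ha.1 hb.1).mul_pow, ha.2, hb.2, one_mul]⟩
  inv_mem' := fun ha => ⟨inv_mem ha.1, by rw [inv_pow, ha.2, inv_one]⟩

instance (p : ℕ) (hK : lowerCentral 4 K = ⊥) : CommGroup (derivedTorsion p hK) where
  mul_comm a b := Subtype.ext (commute_of_mem_two hK a.2.1 b.2.1).eq

instance (p : ℕ) (hK : lowerCentral 4 K = ⊥) : Module (ZMod p) (Additive (derivedTorsion p hK)) :=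
  AddCommGroup.zmodModule (n := p) fun a =>
    Additive.toMul.injective (Subtype.ext (Additive.toMul a).2.2)

/-- The map `a ↦ [a, x]` on the `p`-torsion of the derived subgroup. -/
def commEnd (p : ℕ) (hK : lowerCentral 4 K = ⊥) (x : K) :
    derivedTorsion p hK →* derivedTorsion p hK where
  toFun a := ⟨comm a x, lowerCentral_three_le_two (comm_mem_lowerCentral_succ (k := 1) a.2.1 x), by
    rw [← comm_pow_left hK a.2.1, a.2.2, comm_one_left]⟩
  map_one' := Subtype.ext (comm_one_left x)
  map_mul' a b := Subtype.ext (comm_mul_left hK a.2.1 x)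

variable {p n : ℕ} [Fact p.Prime] {U : Type*} [AddCommGroup U] [Module (ZMod p) U]
  (u : Module.Basis (Fin n) (ZMod p) U)

/-- A homomorphism `V ⊕ W → K` that sends `u_j ∧ u_i` to `[x_j, x_i]` and is compatible with
commutation with the `x_k`. -/
structure IsCommutatorHom (x : Fin n → K)
    (θ : Multiplicative (V (ZMod p) U × W (ZMod p) U) →* K) : Prop where
  wedge : ∀ j i, θ (.ofAdd (wedge (ZMod p) (u j) (u i), 0)) = comm (x j) (x i)
  phi : ∀ k v, θ (.ofAdd (0, phi (ZMod p) (u k) v)) = comm (θ (.ofAdd (v, 0))) (x k)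
  mem : ∀ t, θ t ∈ lowerCentral 2 K

theorem two_ne_zero_zmod (hp2 : p ≠ 2) : (2 : ZMod p) ≠ 0 := by
  intro h
  have : ((2 : ℕ) : ZMod p) = 0 := by exact_mod_cast h
  rw [ZMod.natCast_eq_zero_iff] at this
  exact hp2 ((Nat.prime_dvd_prime_iff_eq Fact.out Nat.prime_two).1 this)

/-- The values lie in the `𝔽_p`-space `derivedTorsion`; the Hall–Witt identity is the Jacobi
relation needed to extend from `V` to `W`. Requiring only that `x_i^p` commute with the `x_j` also
covers lifts to a central extension. -/
theorem exists_isCommutatorHom (hp2 : p ≠ 2) (hK : lowerCentral 4 K = ⊥) (x : Fin n → K)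
    (hx : ∀ i j, Commute (x i ^ p) (x j)) : ∃ θ, IsCommutatorHom u x θ := by
  let c (i j : Fin n) : derivedTorsion p hK :=
    ⟨comm (x i) (x j), comm_mem_lowerCentral_two _ _, comm_pow_eq_one hK Fact.out hp2 (hx i j)⟩
  obtain ⟨f, hf⟩ := exists_linearMap_wedge u (two_ne_zero_zmod hp2)
    (fun i j => Additive.ofMul (c i j)) fun i j =>
      congrArg Additive.ofMul (Subtype.ext (comm_inv (x i) (x j)).symm)
  obtain ⟨h, hh⟩ := exists_linearMap_phi u f
    (fun k => (MonoidHom.toAdditive (commEnd p hK (x k))).toZModLinearMap p) fun i j k => by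
      simp only [hf]
      exact congrArg Additive.ofMul (Subtype.ext (comm_jacobi hK (x i) (x j) (x k)))
  let θ' : Multiplicative (V (ZMod p) U × W (ZMod p) U) →* derivedTorsion p hK :=
    AddMonoidHom.toMultiplicativeLeft (f.coprod h).toAddMonoidHom
  have hθ (v w) : θ' (.ofAdd (v, w)) = Additive.toMul (f v + h w) := rfl
  refine ⟨(derivedTorsion p hK).subtype.comp θ', ⟨fun j i => ?_, fun k v => ?_, fun t => ?_⟩⟩
  · simp only [MonoidHom.comp_apply, hθ, hf, map_zero, add_zero]
    rfl
  · simp only [MonoidHom.comp_apply, hθ, hh, map_zero, add_zero, zero_add]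
    rfl
  · exact (θ' t).2.1

variable {u}

theorem IsCommutatorHom.map {L : Type*} [Group L] {x : Fin n → K}
    {θ : Multiplicative (V (ZMod p) U × W (ZMod p) U) →* K} (hθ : IsCommutatorHom u x θ)
    (f : K →* L) : IsCommutatorHom u (f ∘ x) (f.comp θ) where
  wedge j i := by simp [hθ.wedge, map_comm]
  phi k v := by simp [hθ.phi, map_comm]
  mem t := by
    have : f (θ t) ∈ (lowerCentral 2 K).map f := ⟨_, hθ.mem t, rfl⟩
    rw [Subgroup.map_lowerCentralSeries] at this
    exact Subgroup.lowerCentralSeries_mono _ le_top this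

theorem apply_prod_eq (θ : Multiplicative (V (ZMod p) U × W (ZMod p) U) →* K) (v w) :
    θ (.ofAdd (v, w)) = θ (.ofAdd (v, 0)) * θ (.ofAdd (0, w)) := by
  rw [← map_mul, ← ofAdd_add]; simp

variable (p) in
/-- The preimage of a subgroup under a homomorphism on the multiplicative version of an
`𝔽_p`-vector space. -/
def comapSubmodule {M : Type*} [AddCommGroup M] [Module (ZMod p) M]
    (θ : Multiplicative M →* K) (S : Subgroup K) : Submodule (ZMod p) M :=
  AddSubgroup.toZModSubmodule p (S.comap θ).toAddSubgroup'

variable (p U) in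
/-- The inclusion of `V` in `V ⊕ W`. -/
def inlHom : Multiplicative (V (ZMod p) U) →* Multiplicative (V (ZMod p) U × W (ZMod p) U) :=
  AddMonoidHom.toMultiplicative (AddMonoidHom.inl _ _)

variable (p U) in
/-- The inclusion of `W` in `V ⊕ W`. -/
def inrHom : Multiplicative (W (ZMod p) U) →* Multiplicative (V (ZMod p) U × W (ZMod p) U) :=
  AddMonoidHom.toMultiplicative (AddMonoidHom.inr _ _)

variable (u) in
theorem apply_inl_mem (θ : Multiplicative (V (ZMod p) U × W (ZMod p) U) →* K) (S : Subgroup K)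
    (h : ∀ i j, i < j → θ (.ofAdd (wedge (ZMod p) (u j) (u i), 0)) ∈ S) (v) :
    θ (.ofAdd (v, 0)) ∈ S := by
  have := eq_top_of_wedge_mem u (comapSubmodule p (θ.comp (inlHom p U)) S) h
  have hv : v ∈ comapSubmodule p (θ.comp (inlHom p U)) S := this ▸ Submodule.mem_top
  exact hv

variable (u) in
theorem apply_inr_mem (θ : Multiplicative (V (ZMod p) U × W (ZMod p) U) →* K) (S : Subgroup K)
    (h : ∀ k v, θ (.ofAdd (0, phi (ZMod p) (u k) v)) ∈ S) (w) :
    θ (.ofAdd (0, w)) ∈ S := by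
  have := eq_top_of_phi_mem u (comapSubmodule p (θ.comp (inrHom p U)) S) h
  have hw : w ∈ comapSubmodule p (θ.comp (inrHom p U)) S := this ▸ Submodule.mem_top
  exact hw

theorem commutatorHom_ext {θ θ' : Multiplicative (V (ZMod p) U × W (ZMod p) U) →* K}
    (hw : ∀ j i, θ (.ofAdd (wedge (ZMod p) (u j) (u i), 0))
      = θ' (.ofAdd (wedge (ZMod p) (u j) (u i), 0)))
    (hphi : ∀ j i k, θ (.ofAdd (0, phi (ZMod p) (u k) (wedge (ZMod p) (u j) (u i))))
      = θ' (.ofAdd (0, phi (ZMod p) (u k) (wedge (ZMod p) (u j) (u i))))) : θ = θ' := by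
  have h1 (v) : .ofAdd (v, 0) ∈ MonoidHom.eqLocus θ θ' :=
    apply_inl_mem u (MonoidHom.id _) _ (fun i j _ => hw j i) v
  have h2 (w) : .ofAdd (0, w) ∈ MonoidHom.eqLocus θ θ' := by
    have := eq_top_of_hall_mem u
      (comapSubmodule p (inrHom p U) (MonoidHom.eqLocus θ θ')) fun i j k _ _ => hphi j i k
    have hw : w ∈ comapSubmodule p (inrHom p U) (MonoidHom.eqLocus θ θ') :=
      this ▸ Submodule.mem_top
    exact hw
  refine MonoidHom.ext fun t => ?_
  have ht : t = .ofAdd ((Multiplicative.toAdd t).1, (Multiplicative.toAdd t).2) := rfl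
  rw [ht, apply_prod_eq θ, apply_prod_eq θ']
  exact congrArg₂ (· * ·) (h1 _) (h2 _)

theorem IsCommutatorHom.ext {x : Fin n → K}
    {θ θ' : Multiplicative (V (ZMod p) U × W (ZMod p) U) →* K} (hθ : IsCommutatorHom u x θ)
    (hθ' : IsCommutatorHom u x θ') : θ = θ' :=
  commutatorHom_ext (fun j i => by rw [hθ.wedge, hθ'.wedge])
    fun j i k => by rw [hθ.phi, hθ'.phi, hθ.wedge, hθ'.wedge]

theorem IsCommutatorHom.mem_three {x : Fin n → K}
    {θ : Multiplicative (V (ZMod p) U × W (ZMod p) U) →* K} (hθ : IsCommutatorHom u x θ) (w) :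
    θ (.ofAdd (0, w)) ∈ lowerCentral 3 K :=
  apply_inr_mem u θ _ (fun k v => by
    rw [hθ.phi]; exact comm_mem_lowerCentral_succ (k := 1) (hθ.mem _) _) w

/-- The `W`-part lands in the central `K_3` and drops out. -/
theorem IsCommutatorHom.comm_apply (hK : lowerCentral 4 K = ⊥) {x : Fin n → K}
    {θ : Multiplicative (V (ZMod p) U × W (ZMod p) U) →* K} (hθ : IsCommutatorHom u x θ) (v w k) :
    comm (θ (.ofAdd (v, w))) (x k) = θ (.ofAdd (0, CapableGroups.phi (ZMod p) (u k) v)) := by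
  rw [apply_prod_eq, comm_mul_left_of_mem_three hK (hθ.mem _) (hθ.mem_three w), hθ.phi]

end Theta

/-! ### The group of unitriangular `4 × 4` matrices -/

section Unitriangular

/-- A unitriangular `4 × 4` matrix, given by its entries above the diagonal. -/
@[ext] structure Unitriangular (R : Type*) where
  /-- the entry `(1, 2)` -/
  a : R
  /-- the entry `(2, 3)` -/
  b : R
  /-- the entry `(3, 4)` -/
  c : R
  /-- the entry `(1, 3)` -/
  d : R
  /-- the entry `(2, 4)` -/
  e : R
  /-- the entry `(1, 4)` -/
  f : R

namespace Unitriangular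

variable {R : Type*} [CommRing R]

instance : One (Unitriangular R) := ⟨⟨0, 0, 0, 0, 0, 0⟩⟩

instance : Mul (Unitriangular R) :=
  ⟨fun x y => ⟨x.a + y.a, x.b + y.b, x.c + y.c, x.d + y.d + x.a * y.b, x.e + y.e + x.b * y.c,
    x.f + y.f + x.a * y.e + x.d * y.c⟩⟩

instance : Inv (Unitriangular R) :=
  ⟨fun x => ⟨-x.a, -x.b, -x.c, -x.d + x.a * x.b, -x.e + x.b * x.c,
    -x.f + x.a * x.e + x.d * x.c - x.a * x.b * x.c⟩⟩

theorem one_def : (1 : Unitriangular R) = ⟨0, 0, 0, 0, 0, 0⟩ := rfl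

theorem mul_def (x y : Unitriangular R) : x * y =
    ⟨x.a + y.a, x.b + y.b, x.c + y.c, x.d + y.d + x.a * y.b, x.e + y.e + x.b * y.c,
    x.f + y.f + x.a * y.e + x.d * y.c⟩ := rfl

theorem inv_def (x : Unitriangular R) : x⁻¹ =
    ⟨-x.a, -x.b, -x.c, -x.d + x.a * x.b, -x.e + x.b * x.c,
    -x.f + x.a * x.e + x.d * x.c - x.a * x.b * x.c⟩ := rfl

instance : Group (Unitriangular R) :=
  Group.ofLeftAxioms
    (fun x y z => by simp only [mul_def, mk.injEq]; refine ⟨?_, ?_, ?_, ?_, ?_, ?_⟩ <;> ring)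
    (fun x => by simp [mul_def, one_def])
    (fun x => by
      simp only [mul_def, inv_def, one_def, mk.injEq]; refine ⟨?_, ?_, ?_, ?_, ?_, ?_⟩ <;> ring)

variable (R) in
/-- The matrices with vanishing first superdiagonal. -/
def two : Subgroup (Unitriangular R) where
  carrier := {x | x.a = 0 ∧ x.b = 0 ∧ x.c = 0}
  one_mem' := ⟨rfl, rfl, rfl⟩
  mul_mem' := by rintro x y ⟨h1, h2, h3⟩ ⟨h4, h5, h6⟩; simp [mul_def, *]
  inv_mem' := by rintro x ⟨h1, h2, h3⟩; simp [inv_def, *]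

variable (R) in
/-- The matrices with vanishing first and second superdiagonals. -/
def three : Subgroup (Unitriangular R) where
  carrier := {x | x.a = 0 ∧ x.b = 0 ∧ x.c = 0 ∧ x.d = 0 ∧ x.e = 0}
  one_mem' := ⟨rfl, rfl, rfl, rfl, rfl⟩
  mul_mem' := by rintro x y ⟨h1, h2, h3, h4, h5⟩ ⟨h6, h7, h8, h9, h10⟩; simp [mul_def, *]
  inv_mem' := by rintro x ⟨h1, h2, h3, h4, h5⟩; simp [inv_def, *]

/-- The entry `(1, 4)` is left open: neither a further commutator nor the entry `(1, 3)` depends on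
it. -/
theorem comm_eq (x y : Unitriangular R) : ∃ f, comm x y =
    ⟨0, 0, 0, x.a * y.b - y.a * x.b, x.b * y.c - y.b * x.c, f⟩ := by
  refine ⟨(comm x y).f, ?_⟩
  ext <;> simp only [comm, mul_def, inv_def] <;> ring

theorem comm_eq_of_mem_two {x : Unitriangular R} (hx : x ∈ two R) (y : Unitriangular R) :
    comm x y = ⟨0, 0, 0, 0, 0, x.d * y.c - y.a * x.e⟩ := by
  obtain ⟨h1, h2, h3⟩ := hx
  ext <;> simp only [comm, mul_def, inv_def, h1, h2, h3] <;> ring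

theorem commutatorElement_eq (x y : Unitriangular R) : ⁅x, y⁆ = comm x⁻¹ y⁻¹ := by
  rw [comm_eq_commutatorElement, inv_inv, inv_inv]

theorem lowerCentral_two_le : lowerCentral 2 (Unitriangular R) ≤ two R := by
  refine Subgroup.commutator_le.2 fun x _ y _ => ?_
  obtain ⟨f, hf⟩ := comm_eq x⁻¹ y⁻¹
  rw [commutatorElement_eq, hf]
  exact ⟨rfl, rfl, rfl⟩

theorem lowerCentral_three_le : lowerCentral 3 (Unitriangular R) ≤ three R := by
  refine Subgroup.commutator_le.2 fun x hx y _ => ?_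
  rw [commutatorElement_eq, comm_eq_of_mem_two (inv_mem (lowerCentral_two_le hx))]
  exact ⟨rfl, rfl, rfl, rfl, rfl⟩

theorem lowerCentral_four : lowerCentral 4 (Unitriangular R) = ⊥ := by
  refine eq_bot_iff.2 (Subgroup.commutator_le.2 fun x hx y _ => ?_)
  obtain ⟨h1, h2, h3, h4, h5⟩ := inv_mem (lowerCentral_three_le hx)
  rw [commutatorElement_eq, comm_eq_of_mem_two ⟨h1, h2, h3⟩, h4, h5, Subgroup.mem_bot, one_def]
  simp

/-- In general the last entry is `m.choose 3 * (a * b * c)`, which need not vanish for `m = p = 3`;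
hence the hypothesis. -/
theorem pow_eq (a b c : R) (h : a * b * c = 0) (m : ℕ) :
    (⟨a, b, c, 0, 0, 0⟩ : Unitriangular R) ^ m =
      ⟨m * a, m * b, m * c, m.choose 2 * (a * b), m.choose 2 * (b * c), 0⟩ := by
  induction m with
  | zero => simp [one_def]
  | succ m ih =>
    rw [pow_succ, ih, mul_def, Nat.choose_succ_succ' m 1, Nat.choose_one_right]
    simp only [mk.injEq]
    push_cast
    refine ⟨by ring, by ring, by ring, by ring, by ring, ?_⟩
    linear_combination (m.choose 2 : R) * h

theorem pow_prime_eq_one {p : ℕ} [Fact p.Prime] (hp2 : p ≠ 2) (a b c : ZMod p)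
    (h : a * b * c = 0) : (⟨a, b, c, 0, 0, 0⟩ : Unitriangular (ZMod p)) ^ p = 1 := by
  have hp : p.Prime := Fact.out
  have hc : ((p.choose 2 : ℕ) : ZMod p) = 0 :=
    (ZMod.natCast_eq_zero_iff _ _).2
      (hp.dvd_choose_self two_ne_zero (lt_of_le_of_ne hp.two_le (Ne.symm hp2)))
  rw [pow_eq a b c h, hc, one_def]
  simp

end Unitriangular

end Unitriangular

/-! ### The group `F` -/

section FGroup

variable {p n : ℕ}

theorem lowerCentral_four_F : lowerCentral 4 (F p n) = ⊥ := by
  have h := Subgroup.map_lowerCentralSeries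
    (⊤ : Subgroup (Monoid.CoprodI fun _ : Fin n => Multiplicative (ZMod p)))
    (QuotientGroup.mk' (lowerCentral 4 (Monoid.CoprodI fun _ : Fin n => Multiplicative (ZMod p)))) 3
  rw [Subgroup.map_top_of_surjective _ (QuotientGroup.mk'_surjective _)] at h
  refine h.symm.trans ?_
  rw [Subgroup.map_eq_bot_iff, QuotientGroup.ker_mk']

theorem gen_pow (i : Fin n) : gen p i ^ p = 1 := by
  rw [gen, ← QuotientGroup.mk_pow, ← map_pow, ← ofAdd_nsmul]
  simp only [nsmul_eq_mul, CharP.cast_eq_zero, zero_mul, ofAdd_zero, map_one]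
  rfl

theorem closure_range_gen [NeZero p] : Subgroup.closure (Set.range (gen p : Fin n → F p n)) = ⊤ := by
  rw [eq_top_iff]
  rintro f -
  obtain ⟨m, rfl⟩ := QuotientGroup.mk_surjective f
  induction m using Monoid.CoprodI.induction_on with
  | one => exact one_mem _
  | mul x y hx hy => exact mul_mem hx hy
  | of i z =>
    have hz : z = (Multiplicative.ofAdd 1) ^ (Multiplicative.toAdd z).val := by
      rw [← ofAdd_nsmul]; simp
    rw [hz, map_pow]
    have hi : gen p i ∈ Subgroup.closure (Set.range (gen p : Fin n → F p n)) :=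
      Subgroup.subset_closure ⟨i, rfl⟩
    exact pow_mem hi _

theorem hom_ext_gen [NeZero p] {L : Type*} [Group L] {f f' : F p n →* L}
    (h : ∀ i, f (gen p i) = f' (gen p i)) : f = f' :=
  MonoidHom.eq_of_eqOn_dense closure_range_gen (by rintro _ ⟨i, rfl⟩; exact h i)

theorem cyclicHom_one {L : Type*} [Group L] (g : L) (hg : g ^ p = 1) :
    cyclicHom g hg (.ofAdd 1) = g := by
  have h : (1 : ZMod p) = ((1 : ℤ) : ZMod p) := by simp
  simp only [cyclicHom, AddMonoidHom.coe_toMultiplicativeLeft, Function.comp, toAdd_ofAdd]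
  rw [h, ZMod.lift_coe]
  simp

theorem exists_hom_F {L : Type*} [Group L] (hL : lowerCentral 4 L = ⊥) (x : Fin n → L)
    (hx : ∀ i, x i ^ p = 1) : ∃ f : F p n →* L, ∀ i, f (gen p i) = x i := by
  refine ⟨NilpotentProduct.lift (k := 3) hL fun i => cyclicHom (x i) (hx i), fun i => ?_⟩
  simp only [NilpotentProduct.lift, gen, QuotientGroup.lift_mk, Monoid.CoprodI.lift_of,
    cyclicHom_one]

/-- The unitriangular representations of `F`. -/
theorem exists_unitriangular_hom [Fact p.Prime] (hp2 : p ≠ 2) (a b c : Fin n → ZMod p)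
    (h : ∀ i, a i * b i * c i = 0) :
    ∃ f : F p n →* Unitriangular (ZMod p), ∀ i, f (gen p i) = ⟨a i, b i, c i, 0, 0, 0⟩ :=
  exists_hom_F Unitriangular.lowerCentral_four _ fun i =>
    Unitriangular.pow_prime_eq_one hp2 _ _ _ (h i)

end FGroup

/-! ### The identification of `F_2` with `V ⊕ W` -/

section Identify

/-- Nonzero diagonal values suffice, rather than `1`; the value `-2` does occur below. -/
theorem eq_zero_of_dual_family {R M ι : Type*} [Field R] [AddCommGroup M] [Module R M] [Fintype ι]
    (b : ι → M) (hb : Submodule.span R (Set.range b) = ⊤) (l : ι → M →ₗ[R] R)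
    (hdiag : ∀ s, l s (b s) ≠ 0) (hoff : ∀ s t, t ≠ s → l s (b t) = 0) (x : M)
    (hx : ∀ s, l s x = 0) : x = 0 := by
  obtain ⟨c, rfl⟩ := (Submodule.mem_span_range_iff_exists_fun R).1
    (hb ▸ Submodule.mem_top : x ∈ Submodule.span R (Set.range b))
  refine Finset.sum_eq_zero fun s _ => ?_
  have h := hx s
  rw [map_sum, Finset.sum_eq_single s (fun t _ ht => by rw [map_smul, hoff s t ht, smul_zero])
    (fun h => absurd (Finset.mem_univ s) h), map_smul, smul_eq_mul] at h
  rw [(mul_eq_zero.1 h).resolve_right (hdiag s), zero_smul]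

theorem ite_mul_ite_mul_ite {R : Type*} [CommRing R] {P Q S : Prop} [Decidable P] [Decidable Q]
    [Decidable S] (h : ¬(P ∧ Q ∧ S)) :
    (if P then (1 : R) else 0) * (if Q then 1 else 0) * (if S then 1 else 0) = 0 := by
  split_ifs <;> simp_all

variable {p n : ℕ} [Fact p.Prime] {U : Type*} [AddCommGroup U] [Module (ZMod p) U]
  {u : Module.Basis (Fin n) (ZMod p) U}

theorem entry_d_mul {x y : Unitriangular (ZMod p)} (hx : x ∈ Unitriangular.two (ZMod p)) :
    (x * y).d = x.d + y.d := by
  simp [Unitriangular.mul_def, hx.1]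

theorem entry_f_mul {x y : Unitriangular (ZMod p)} (hx : x ∈ Unitriangular.two (ZMod p))
    (hy : y ∈ Unitriangular.two (ZMod p)) : (x * y).f = x.f + y.f := by
  simp [Unitriangular.mul_def, hx.1, hy.2.2]

variable {a b c : Fin n → ZMod p}
  {η : Multiplicative (V (ZMod p) U × W (ZMod p) U) →* Unitriangular (ZMod p)}
  (hη : IsCommutatorHom u (fun i => (⟨a i, b i, c i, 0, 0, 0⟩ : Unitriangular (ZMod p))) η)

/-- The entry `(1, 3)` as a linear functional on `V`. -/
def entryD : V (ZMod p) U →ₗ[ZMod p] ZMod p :=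
  AddMonoidHom.toZModLinearMap p (AddMonoidHom.mk' (fun v => (η (.ofAdd (v, 0))).d) fun v w => by
    rw [← entry_d_mul (Unitriangular.lowerCentral_two_le (hη.mem _)), ← map_mul, ← ofAdd_add,
      Prod.mk_add_mk, add_zero])

/-- The entry `(1, 4)` as a linear functional on `W`. -/
def entryF : W (ZMod p) U →ₗ[ZMod p] ZMod p :=
  AddMonoidHom.toZModLinearMap p (AddMonoidHom.mk' (fun w => (η (.ofAdd (0, w))).f) fun v w => by
    rw [← entry_f_mul (Unitriangular.lowerCentral_two_le (hη.mem _))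
      (Unitriangular.lowerCentral_two_le (hη.mem _)), ← map_mul, ← ofAdd_add,
      Prod.mk_add_mk, add_zero])

theorem entryD_wedge (j i : Fin n) :
    entryD hη (wedge (ZMod p) (u j) (u i)) = a j * b i - a i * b j := by
  change (η _).d = _
  obtain ⟨f, hf⟩ := Unitriangular.comm_eq (⟨a j, b j, c j, 0, 0, 0⟩ : Unitriangular (ZMod p))
    ⟨a i, b i, c i, 0, 0, 0⟩
  rw [hη.wedge, hf]

theorem entryF_phi (j i k : Fin n) :
    entryF hη (phi (ZMod p) (u k) (wedge (ZMod p) (u j) (u i))) =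
      (a j * b i - a i * b j) * c k - a k * (b j * c i - b i * c j) := by
  change (η _).f = _
  obtain ⟨f, hf⟩ := Unitriangular.comm_eq (⟨a j, b j, c j, 0, 0, 0⟩ : Unitriangular (ZMod p))
    ⟨a i, b i, c i, 0, 0, 0⟩
  rw [hη.phi, hη.wedge, hf, Unitriangular.comm_eq_of_mem_two ⟨rfl, rfl, rfl⟩]

/-- Coordinates are read off from matrices. For `i < j`, the superdiagonal `(e_i, e_j, 0)` makes the
entry `(1, 3)` detect `u_j ∧ u_i`; for a Hall triple, `(e_i, e_j, e_k)` makes the entry `(1, 4)`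
detect `φ_{u_k}(u_j ∧ u_i)`. -/
theorem injective_of_isCommutatorHom_gen (hp2 : p ≠ 2)
    {θ : Multiplicative (V (ZMod p) U × W (ZMod p) U) →* F p n}
    (hθ : IsCommutatorHom u (gen p) θ) : Function.Injective θ := by
  have rep (a b c : Fin n → ZMod p) (h : ∀ i, a i * b i * c i = 0) :
      ∃ ρ : F p n →* Unitriangular (ZMod p), IsCommutatorHom u
        (fun i => (⟨a i, b i, c i, 0, 0, 0⟩ : Unitriangular (ZMod p))) (ρ.comp θ) := by
    obtain ⟨ρ, hρ⟩ := exists_unitriangular_hom hp2 a b c h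
    refine ⟨ρ, ?_⟩
    rw [← show ρ ∘ gen p = _ from funext hρ]
    exact hθ.map ρ
  rw [injective_iff_map_eq_one]
  intro t ht
  obtain ⟨v, w, rfl⟩ : ∃ v w, t = .ofAdd (v, w) :=
    ⟨(Multiplicative.toAdd t).1, (Multiplicative.toAdd t).2, rfl⟩
  have hv : v = 0 := by
    have hr (s : {s : Fin n × Fin n // s.2 < s.1}) := rep (Pi.single s.1.2 1) (Pi.single s.1.1 1) 0
      (by simp)
    choose ρ hρ using hr
    refine eq_zero_of_dual_family (R := ZMod p)
      (fun s : {s : Fin n × Fin n // s.2 < s.1} => wedge (ZMod p) (u s.1.1) (u s.1.2))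
      (eq_top_of_wedge_mem u _ fun i j hij => Submodule.subset_span ⟨⟨(j, i), hij⟩, rfl⟩)
      (fun s => entryD (hρ s)) ?_ ?_ v ?_
    · rintro ⟨⟨j, i⟩, h⟩
      rw [entryD_wedge]
      simp [h.ne, h.ne']
    · rintro ⟨⟨j, i⟩, h⟩ ⟨⟨j', i'⟩, h'⟩ hne
      rw [entryD_wedge]
      simp only [Pi.single_apply, ne_eq, Subtype.mk.injEq, Prod.mk.injEq] at *
      split_ifs <;> simp <;> first | omega | (subst_vars; simp at *; omega)
    · intro s
      change (ρ s (θ _)).d = 0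
      rw [apply_prod_eq] at ht
      have h1 : ρ s (θ (.ofAdd (v, 0))) * ρ s (θ (.ofAdd (0, w))) = 1 := by
        rw [← map_mul, ht, map_one]
      have h2 : (ρ s (θ (.ofAdd (v, 0)))).d + (ρ s (θ (.ofAdd (0, w)))).d = 0 :=
        (entry_d_mul (Unitriangular.lowerCentral_two_le ((hρ s).mem _))).symm.trans
          (congrArg Unitriangular.d h1)
      have h3 : (ρ s (θ (.ofAdd (0, w)))).d = 0 :=
        (Unitriangular.lowerCentral_three_le ((hρ s).mem_three w)).2.2.2.1
      rwa [h3, add_zero] at h2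
  subst hv
  have hw : w = 0 := by
    have hr (s : HallTriple n) := rep (Pi.single s.1.2.1 1) (Pi.single s.1.1 1)
      (Pi.single s.1.2.2 1) (by
        intro i
        have := s.2.1
        simp only [Pi.single_apply]
        split_ifs <;> simp
        omega)
    choose ρ hρ using hr
    refine eq_zero_of_dual_family (R := ZMod p)
      (fun s : HallTriple n => phi (ZMod p) (u s.1.2.2) (wedge (ZMod p) (u s.1.1) (u s.1.2.1)))
      (eq_top_of_hall_mem u _ fun i j k hij hik =>
        Submodule.subset_span ⟨⟨(j, i, k), hij, hik⟩, rfl⟩)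
      (fun s => entryF (hρ s)) ?_ ?_ w ?_
    · rintro ⟨⟨j, i, k⟩, h, h'⟩
      rw [entryF_phi]
      simp only [Pi.single_eq_same, Pi.single_eq_of_ne h.ne, Pi.single_eq_of_ne h.ne']
      by_cases hik : i = k
      · subst hik
        simp only [Pi.single_eq_same]
        refine ne_of_eq_of_ne (b := -2) (by ring) ?_
        exact neg_ne_zero.2 (two_ne_zero_zmod hp2)
      · simp [hik, Ne.symm hik]
    · rintro ⟨⟨j, i, k⟩, h1, h2⟩ ⟨⟨j', i', k'⟩, h1', h2'⟩ hne
      rw [entryF_phi]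
      simp only [Pi.single_apply, ne_eq, Subtype.mk.injEq, Prod.mk.injEq] at h1 h2 h1' h2' hne ⊢
      -- Each of the four monomials of `entryF_phi` can only be nonzero if the triples coincide or
      -- one violates the Hall inequalities.
      have e1 := ite_mul_ite_mul_ite (R := ZMod p) (P := j' = i) (Q := i' = j) (S := k' = k)
        (by omega)
      have e2 := ite_mul_ite_mul_ite (R := ZMod p) (P := i' = i) (Q := j' = j) (S := k' = k)
        (by omega)
      have e3 := ite_mul_ite_mul_ite (R := ZMod p) (P := k' = i) (Q := j' = j) (S := i' = k)
        (by omega)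
      have e4 := ite_mul_ite_mul_ite (R := ZMod p) (P := k' = i) (Q := i' = j) (S := j' = k)
        (by omega)
      linear_combination e1 - e2 - e3 + e4
    · intro s
      change (ρ s (θ _)).f = 0
      rw [ht, map_one]
      rfl
  rw [hw]
  rfl

end Identify

/-! ### Images of `V` and `W`, complements of `F_3`, and elements of `F_2` -/

section Structure

variable {K : Type*} [Group K] {p n : ℕ} [Fact p.Prime] {U : Type*} [AddCommGroup U]
  [Module (ZMod p) U] {u : Module.Basis (Fin n) (ZMod p) U}

theorem mem_of_closure_eq_top {x : Fin n → K} (hgen : Subgroup.closure (Set.range x) = ⊤)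
    {S : Subgroup K} (h : ∀ i, x i ∈ S) (y : K) : y ∈ S := by
  have : (⊤ : Subgroup K) ≤ S := by
    rw [← hgen, Subgroup.closure_le]
    exact Set.range_subset_iff.2 h
  exact this (Subgroup.mem_top y)

theorem commute_of_forall_commute_gen {x : Fin n → K}
    (hgen : Subgroup.closure (Set.range x) = ⊤) {z : K} (h : ∀ i, Commute z (x i)) (y : K) :
    Commute z y :=
  (Subgroup.mem_centralizer_singleton_iff.1
    (mem_of_closure_eq_top hgen (S := Subgroup.centralizer {z})
      (fun i => Subgroup.mem_centralizer_singleton_iff.2 (h i).symm.eq) y)).symm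

variable {x : Fin n → K} {θ : Multiplicative (V (ZMod p) U × W (ZMod p) U) →* K}

theorem IsCommutatorHom.comm_mem_range_inr (hK : lowerCentral 4 K = ⊥)
    (hgen : Subgroup.closure (Set.range x) = ⊤) (hθ : IsCommutatorHom u x θ) (t) (y : K) :
    comm (θ t) y ∈ (θ.comp (inrHom p U)).range := by
  refine mem_of_closure_eq_top hgen
    (S := (θ.comp (inrHom p U)).range.comap (commRightHom hK (hθ.mem t))) (fun k => ?_) y
  exact ⟨.ofAdd (CapableGroups.phi (ZMod p) (u k) (Multiplicative.toAdd t).1),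
    (hθ.comm_apply hK _ (Multiplicative.toAdd t).2 k).symm⟩

/-- Conjugation changes `θ t` by an element of `θ(W)`, so the range is normal; modulo it the
generators commute, so the quotient is abelian. -/
theorem IsCommutatorHom.range_eq (hK : lowerCentral 4 K = ⊥)
    (hgen : Subgroup.closure (Set.range x) = ⊤) (hθ : IsCommutatorHom u x θ) :
    θ.range = lowerCentral 2 K := by
  refine le_antisymm (by rintro _ ⟨t, rfl⟩; exact hθ.mem t) ?_
  have hnormal : θ.range.Normal := ⟨by
    rintro _ ⟨t, rfl⟩ y
    have h : y * θ t * y⁻¹ = θ t * comm (θ t) y⁻¹ := by simp [comm, mul_assoc]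
    obtain ⟨w, hw⟩ := hθ.comm_mem_range_inr hK hgen t y⁻¹
    rw [h, ← hw]
    exact mul_mem ⟨t, rfl⟩ ⟨_, rfl⟩⟩
  let π := QuotientGroup.mk' θ.range
  have hgen' : Subgroup.closure (Set.range (π ∘ x)) = ⊤ := by
    rw [Set.range_comp, ← MonoidHom.map_closure, hgen,
      Subgroup.map_top_of_surjective _ (QuotientGroup.mk'_surjective _)]
  have h1 (j) (y) : Commute (π (x j)) y := by
    refine commute_of_forall_commute_gen hgen' (fun i => ?_) y
    rw [← comm_eq_one_iff, Function.comp_apply, ← map_comm, ← hθ.wedge]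
    exact (QuotientGroup.eq_one_iff _).2 ⟨_, rfl⟩
  have h2 (z y) : Commute z y :=
    commute_of_forall_commute_gen hgen' (fun i => (h1 i z).symm) y
  refine Subgroup.commutator_le.2 fun y _ z _ => (QuotientGroup.eq_one_iff _).1 ?_
  change π ⁅y, z⁆ = 1
  rw [map_commutatorElement, commutatorElement_eq_one_iff_commute]
  exact h2 _ _

theorem IsCommutatorHom.range_inr_eq (hK : lowerCentral 4 K = ⊥)
    (hgen : Subgroup.closure (Set.range x) = ⊤) (hθ : IsCommutatorHom u x θ) :
    (θ.comp (inrHom p U)).range = lowerCentral 3 K := by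
  refine le_antisymm (by rintro _ ⟨w, rfl⟩; exact hθ.mem_three _) ?_
  refine Subgroup.commutator_le.2 fun y hy z _ => ?_
  obtain ⟨t, ht⟩ : y⁻¹ ∈ θ.range := by rw [hθ.range_eq hK hgen]; exact inv_mem hy
  have : ⁅y, z⁆ = comm (θ t) z⁻¹ := by rw [ht, comm_eq_commutatorElement, inv_inv, inv_inv]
  rw [this]
  exact hθ.comm_mem_range_inr hK hgen t _

theorem range_inl_eq_C {θ : Multiplicative (V (ZMod p) U × W (ZMod p) U) →* F p n}
    (hθ : IsCommutatorHom u (gen p) θ) : (θ.comp (inlHom p U)).range = C p n := by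
  apply le_antisymm
  · rintro _ ⟨v, rfl⟩
    refine apply_inl_mem u θ (C p n) (fun i j hij => ?_) _
    rw [hθ.wedge]
    exact Subgroup.subset_closure ⟨i, j, hij, rfl⟩
  · rw [C, Subgroup.closure_le]
    rintro _ ⟨i, j, -, rfl⟩
    exact ⟨.ofAdd (wedge (ZMod p) (u j) (u i)), hθ.wedge j i⟩

theorem exists_eq_of_mem_two {θ : Multiplicative (V (ZMod p) U × W (ZMod p) U) →* F p n}
    (hθ : IsCommutatorHom u (gen p) θ) {f : F p n} (hf : f ∈ lowerCentral 2 (F p n)) :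
    ∃ v w, f = θ (.ofAdd (v, w)) := by
  rw [← hθ.range_eq lowerCentral_four_F closure_range_gen] at hf
  obtain ⟨t, rfl⟩ := hf
  exact ⟨(Multiplicative.toAdd t).1, (Multiplicative.toAdd t).2, rfl⟩

variable (u) in
theorem exists_isCommutatorHom_F (hp2 : p ≠ 2) :
    ∃ θ : Multiplicative (V (ZMod p) U × W (ZMod p) U) →* F p n, IsCommutatorHom u (gen p) θ :=
  exists_isCommutatorHom u hp2 lowerCentral_four_F _ fun i j => by
    rw [gen_pow]; exact Commute.one_left _

theorem IsIdentification.coe_eq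
    {e : Multiplicative (V (ZMod p) U × W (ZMod p) U) ≃* lowerCentral 2 (F p n)}
    (he : IsIdentification u e) {θ : Multiplicative (V (ZMod p) U × W (ZMod p) U) →* F p n}
    (hθ : IsCommutatorHom u (gen p) θ) (t) : (e t : F p n) = θ t := by
  have : (lowerCentral 2 (F p n)).subtype.comp e.toMonoidHom = θ :=
    commutatorHom_ext (u := u) (fun j i => (he.1 j i).trans (hθ.wedge j i).symm)
      fun j i k => (he.2 j i k).trans (by rw [hθ.phi, hθ.wedge])
  exact DFunLike.congr_fun this t

variable (u) in
theorem existsUnique_isIdentification (hp2 : p ≠ 2) :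
    ∃! e : Multiplicative (V (ZMod p) U × W (ZMod p) U) ≃* lowerCentral 2 (F p n),
      IsIdentification u e := by
  obtain ⟨θ, hθ⟩ := exists_isCommutatorHom_F u hp2
  refine ⟨MulEquiv.ofBijective (θ.codRestrict _ hθ.mem) ⟨?_, ?_⟩, ⟨?_, ?_⟩, ?_⟩
  · exact fun s t h => injective_of_isCommutatorHom_gen hp2 hθ (congrArg Subtype.val h)
  · rintro ⟨f, hf⟩
    obtain ⟨v, w, rfl⟩ := exists_eq_of_mem_two hθ hf
    exact ⟨_, rfl⟩
  · exact hθ.wedge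
  · intro j i k
    exact (hθ.phi k _).trans (by rw [hθ.wedge])
  · intro e he
    ext t
    exact he.coe_eq hθ t

theorem C_inf_lowerCentral_three (hp2 : p ≠ 2) : C p n ⊓ lowerCentral 3 (F p n) = ⊥ := by
  -- The claim concerns `F` alone, so any space with a basis of `n` vectors will do.
  let u := Pi.basisFun (ZMod p) (Fin n)
  obtain ⟨θ, hθ⟩ := exists_isCommutatorHom_F u hp2
  rw [← range_inl_eq_C hθ, ← hθ.range_inr_eq lowerCentral_four_F closure_range_gen, eq_bot_iff]
  rintro _ ⟨⟨v, rfl⟩, ⟨w, hw⟩⟩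
  have h := congrArg (fun t => (Multiplicative.toAdd t).1)
    (injective_of_isCommutatorHom_gen hp2 hθ hw)
  have hv : v = 1 := Eq.symm h
  rw [hv]
  exact map_one _

/-- The modular law together with `C ⊓ F_3 = ⊥`; this gives uniqueness of `X`. -/
theorem IsRelationSubgroup.eq_inf (hp2 : p ≠ 2) {N X : Subgroup (F p n)}
    (h : IsRelationSubgroup N X) : X = N ⊓ C p n := by
  apply le_antisymm
  · exact le_inf (h.sup_eq ▸ le_sup_left) h.le_C
  · intro y hy
    obtain ⟨hN, hC⟩ := Subgroup.mem_inf.1 hy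
    rw [← h.sup_eq, Subgroup.mem_sup_of_normal_right] at hN
    obtain ⟨a, ha, z, hz, rfl⟩ := hN
    have hz1 : z ∈ C p n ⊓ lowerCentral 3 (F p n) :=
      ⟨(Subgroup.mul_mem_cancel_left _ (h.le_C ha)).1 hC, hz⟩
    rw [C_inf_lowerCentral_three hp2, Subgroup.mem_bot] at hz1
    rwa [hz1, mul_one]

theorem existsUnique_isRelationSubgroup (hp2 : p ≠ 2) {N : Subgroup (F p n)}
    (h3 : lowerCentral 3 (F p n) ≤ N) (h2 : N ≤ lowerCentral 2 (F p n)) :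
    ∃! X, IsRelationSubgroup N X := by
  refine ⟨N ⊓ C p n, ⟨inf_le_right, ?_, ?_⟩, fun X hX => hX.eq_inf hp2⟩
  · rw [inf_assoc, C_inf_lowerCentral_three hp2, inf_bot_eq]
  · refine le_antisymm (sup_le inf_le_left h3) fun f hf => ?_
    let u := Pi.basisFun (ZMod p) (Fin n)
    obtain ⟨θ, hθ⟩ := exists_isCommutatorHom_F u hp2
    obtain ⟨v, w, rfl⟩ := exists_eq_of_mem_two hθ (h2 hf)
    rw [apply_prod_eq] at hf ⊢
    have hw := hθ.mem_three w
    refine Subgroup.mul_mem_sup ⟨(Subgroup.mul_mem_cancel_right _ (h3 hw)).1 hf, ?_⟩ hw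
    rw [← range_inl_eq_C hθ]
    exact ⟨.ofAdd v, rfl⟩

/-- A homomorphism from `F` that sends the generators to a basis has its kernel in the derived
subgroup. -/
theorem mem_two_of_map_eq_one {A : Type*} [AddCommGroup A] [Module (ZMod p) A]
    (b : Module.Basis (Fin n) (ZMod p) A) (q : F p n →* Multiplicative A)
    (hq : ∀ i, q (gen p i) = .ofAdd (b i)) {f : F p n} (hf : q f = 1) :
    f ∈ lowerCentral 2 (F p n) := by
  have hexp : (powMonoidHom p).comp (Abelianization.of (G := F p n)) = 1 :=
    hom_ext_gen fun i => by
      simp only [MonoidHom.comp_apply, powMonoidHom_apply, MonoidHom.one_apply]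
      rw [← map_pow, gen_pow, map_one]
  let _ : Module (ZMod p) (Additive (Abelianization (F p n))) :=
    AddCommGroup.zmodModule (n := p) fun x => by
      obtain ⟨y, hy⟩ := QuotientGroup.mk_surjective (Additive.toMul x)
      have h := DFunLike.congr_fun hexp y
      exact Additive.toMul.injective ((congrArg (· ^ p) hy.symm).trans h)
  -- Composed with `q`, this is the abelianization map on generators, so `ker q` dies in the
  -- abelianization.
  let σ : A →ₗ[ZMod p] Additive (Abelianization (F p n)) :=
    b.constr (ZMod p) fun i => Additive.ofMul (Abelianization.of (gen p i))
  have h : (AddMonoidHom.toMultiplicativeLeft σ.toAddMonoidHom).comp q = Abelianization.of :=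
    hom_ext_gen fun i => by
      rw [MonoidHom.comp_apply, hq]
      change Additive.toMul (σ (b i)) = _
      simp [σ]
  have h' := DFunLike.congr_fun h f
  rw [MonoidHom.comp_apply, hf, map_one] at h'
  exact (QuotientGroup.eq_one_iff f).1 h'.symm

/-- The superdiagonal `(e_i, e_m, 0)` with `m ≠ i` turns the entry `(1, 3)` of `[f, x_m]` into the
exponent sum of `x_i` in `f`, which must vanish. Noncyclicity of `G` enters through the existence of
`m`. -/
theorem mem_two_of_comm_mem_three (hp2 : p ≠ 2) (hn : ∀ i : Fin n, ∃ j, j ≠ i) {f : F p n}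
    (hf : ∀ k, comm f (gen p k) ∈ lowerCentral 3 (F p n)) : f ∈ lowerCentral 2 (F p n) := by
  choose m hm using hn
  have hρ (i : Fin n) := exists_unitriangular_hom hp2 (Pi.single i 1 : Fin n → ZMod p)
    (Pi.single (m i) 1) 0 (by simp)
  choose ρ hρ using hρ
  let q : F p n →* Multiplicative (Fin n → ZMod p) :=
    { toFun := fun f => .ofAdd fun i => (ρ i f).a
      map_one' := by simp only [map_one]; rfl
      map_mul' := fun f g => by simp only [map_mul]; rfl }
  refine mem_two_of_map_eq_one (Pi.basisFun (ZMod p) (Fin n)) q (fun i => ?_) ?_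
  · refine congrArg Multiplicative.ofAdd (funext fun k => ?_)
    rw [hρ, Pi.basisFun_apply]
    simp [Pi.single_apply, eq_comm]
  · refine congrArg Multiplicative.ofAdd (funext fun i => ?_)
    change (ρ i f).a = 0
    have h : ρ i (comm f (gen p (m i))) ∈ lowerCentral 3 (Unitriangular (ZMod p)) := by
      have : ρ i (comm f (gen p (m i))) ∈ (lowerCentral 3 (F p n)).map (ρ i) := ⟨_, hf _, rfl⟩
      rw [Subgroup.map_lowerCentralSeries] at this
      exact Subgroup.lowerCentralSeries_mono _ le_top this
    have hd := (Unitriangular.lowerCentral_three_le h).2.2.2.1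
    obtain ⟨y, hy⟩ := Unitriangular.comm_eq (ρ i f) (ρ i (gen p (m i)))
    rw [map_comm, hy, hρ] at hd
    simpa [hm i] using hd

end Structure

/-! ### Capability -/

section Capable

/-- Quotients of `F` live in the lowest universe, the witness in that of `G`; hence `ULift`. -/
theorem isCapable_of_surjective.{v} {G : Type v} [Group G] {L : Type} [Group L] (f : L →* G)
    (hf : Function.Surjective f) (hker : f.ker = Subgroup.center L) : IsCapable G := by
  let f' : ULift.{v} L →* G := f.comp MulEquiv.ulift.toMonoidHom
  have hf' : Function.Surjective f' := hf.comp MulEquiv.ulift.surjective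
  have hker' : f'.ker = Subgroup.center (ULift.{v} L) := by
    ext ⟨y⟩
    have h1 : (ULift.up y : ULift.{v} L) ∈ f'.ker ↔ y ∈ f.ker := Iff.rfl
    rw [h1, hker, Subgroup.mem_center_iff, Subgroup.mem_center_iff]
    exact ⟨fun h ⟨z⟩ => congrArg ULift.up (h z), fun h z => congrArg ULift.down (h ⟨z⟩)⟩
  exact ⟨ULift.{v} L, inferInstance,
    ⟨((QuotientGroup.quotientMulEquivOfEq hker').symm.trans
      (QuotientGroup.quotientKerEquivOfSurjective f' hf')).symm⟩⟩

theorem IsCapable.exists_surjective.{v} {G : Type v} [Group G] (h : IsCapable G) :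
    ∃ (H : Type v) (_ : Group H) (q : H →* G), Function.Surjective q ∧
      q.ker = Subgroup.center H := by
  obtain ⟨H, _, ⟨e⟩⟩ := h
  refine ⟨H, inferInstance, e.symm.toMonoidHom.comp (QuotientGroup.mk' _),
    e.symm.surjective.comp (QuotientGroup.mk'_surjective _), ?_⟩
  rw [MonoidHom.ker_comp_of_injective _ _ e.symm.injective, QuotientGroup.ker_mk']

theorem mem_addSubgroup_of_basis_mem {p n : ℕ} [Fact p.Prime] {A : Type*} [AddCommGroup A]
    [Module (ZMod p) A] (b : Module.Basis (Fin n) (ZMod p) A) {T : AddSubgroup A}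
    (hT : ∀ i, b i ∈ T) (y : A) : y ∈ T := by
  have h : AddSubgroup.toZModSubmodule p T = ⊤ := eq_top_of_basis_mem b _ hT
  have hy : y ∈ AddSubgroup.toZModSubmodule p T := h ▸ Submodule.mem_top
  exact hy

theorem normal_of_le_center {L : Type*} [Group L] {N : Subgroup L} (h : N ≤ Subgroup.center L) :
    N.Normal :=
  ⟨fun z hz y => by rwa [Subgroup.mem_center_iff.1 (h hz) y, mul_inv_cancel_right]⟩

variable {p n : ℕ} [Fact p.Prime] {G : Type*} [Group G] (hclass : lowerCentral 3 G = ⊥)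
  (hexp : Monoid.exponent G = p) {g : Fin n → G} (hg : ProjectsToBasis hexp g)

include hclass hg in
-- The `g_i` generate modulo the derived subgroup, which is central; commutators ignore central
-- factors, so it is also contained in the closure.
theorem closure_range_eq_top_of_projectsToBasis : Subgroup.closure (Set.range g) = ⊤ := by
  let _ : Module (ZMod p) (Additive (Abelianization G)) := abelianizationModule hexp
  obtain ⟨b, hb⟩ := hg
  set S := Subgroup.closure (Set.range g)
  have hS (y : Additive (Abelianization G)) : y ∈ (S.map Abelianization.of).toAddSubgroup :=
    mem_addSubgroup_of_basis_mem b (fun i => by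
      rw [hb]
      exact ⟨g i, Subgroup.subset_closure ⟨i, rfl⟩, rfl⟩) y
  have hcen : commutator G ≤ Subgroup.center G :=
    Subgroup.commutator_top_right_eq_bot_iff_le_center.1 hclass
  have hdec (y : G) : ∃ s ∈ S, ∃ z ∈ commutator G, y = s * z := by
    obtain ⟨s, hs, hsy⟩ := hS (Additive.ofMul (Abelianization.of y))
    exact ⟨s, hs, s⁻¹ * y, QuotientGroup.eq.1 hsy, by group⟩
  have hcomm : commutator G ≤ S := by
    refine Subgroup.commutator_le.2 fun y _ y' _ => ?_
    obtain ⟨s, hs, z, hz, rfl⟩ := hdec y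
    obtain ⟨s', hs', z', hz', rfl⟩ := hdec y'
    have hz1 (t : G) : t * z = z * t := Subgroup.mem_center_iff.1 (hcen hz) t
    have hz2 (t : G) : t * z' = z' * t := Subgroup.mem_center_iff.1 (hcen hz') t
    have : ⁅s * z, s' * z'⁆ = ⁅s, s'⁆ := by
      simp only [commutatorElement_def, mul_inv_rev]
      rw [show s * z * (s' * z') * (z⁻¹ * s⁻¹) * (z'⁻¹ * s'⁻¹)
        = s * (z * (s' * z')) * z⁻¹ * s⁻¹ * z'⁻¹ * s'⁻¹ by group, ← hz1,
        show s * (s' * z' * z) * z⁻¹ * s⁻¹ * z'⁻¹ * s'⁻¹ = s * s' * (z' * s⁻¹) * z'⁻¹ * s'⁻¹ by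
          group, ← hz2]
      group
    rw [this]
    exact S.mul_mem (S.mul_mem (S.mul_mem hs hs') (S.inv_mem hs)) (S.inv_mem hs')
  rw [eq_top_iff]
  rintro y -
  obtain ⟨s, hs, z, hz, rfl⟩ := hdec y
  exact S.mul_mem hs (hcomm hz)

include hclass hg in
theorem psi_surjective : Function.Surjective (psi hclass hexp g) := by
  rw [← MonoidHom.range_eq_top, eq_top_iff,
    ← closure_range_eq_top_of_projectsToBasis hclass hexp hg, Subgroup.closure_le]
  rintro _ ⟨i, rfl⟩
  exact ⟨gen p i, psi_gen hclass hexp g i⟩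

include hclass hg in
theorem exists_ne_of_not_isCyclic (hcyc : ¬ IsCyclic G) (i : Fin n) : ∃ j, j ≠ i := by
  by_contra! h
  refine hcyc ⟨g i, fun y => ?_⟩
  have hy : y ∈ Subgroup.closure (Set.range g) := by
    rw [closure_range_eq_top_of_projectsToBasis hclass hexp hg]; trivial
  change y ∈ Subgroup.zpowers (g i)
  rw [Subgroup.zpowers_eq_closure]
  refine Subgroup.closure_mono ?_ hy
  rintro _ ⟨j, rfl⟩
  rw [h j]
  rfl

omit [Fact p.Prime] in
theorem lowerCentral_three_le_ker_psi :
    lowerCentral 3 (F p n) ≤ (psi hclass hexp g).ker := by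
  rw [← Subgroup.map_eq_bot_iff, Subgroup.map_lowerCentralSeries, eq_bot_iff, ← hclass]
  exact Subgroup.lowerCentralSeries_mono _ le_top

include hg in
theorem ker_psi_le : (psi hclass hexp g).ker ≤ lowerCentral 2 (F p n) := by
  let _ : Module (ZMod p) (Additive (Abelianization G)) := abelianizationModule hexp
  obtain ⟨b, hb⟩ := hg
  intro f hf
  refine mem_two_of_map_eq_one b
    ((MulEquiv.multiplicativeAdditive (Abelianization G)).symm.toMonoidHom.comp
      (Abelianization.of.comp (psi hclass hexp g))) (fun i => ?_) ?_
  · rw [hb, MonoidHom.comp_apply, MonoidHom.comp_apply, psi_gen]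
    rfl
  · rw [MonoidHom.comp_apply, MonoidHom.comp_apply, hf, map_one, map_one]

variable {U : Type*} [AddCommGroup U] [Module (ZMod p) U] {u : Module.Basis (Fin n) (ZMod p) U}

theorem phi_mem_of_basis {S : Submodule (ZMod p) (W (ZMod p) U)} {v : V (ZMod p) U}
    (h : ∀ k, phi (ZMod p) (u k) v ∈ S) (a : U) : phi (ZMod p) a v ∈ S := by
  have h1 : S.comap ((phiBilin (ZMod p) U).flip v) = ⊤ := eq_top_of_basis_mem u _ h
  have h2 : a ∈ S.comap ((phiBilin (ZMod p) U).flip v) := h1 ▸ Submodule.mem_top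
  exact h2

theorem phi_mem_upStar {X : Submodule (ZMod p) (V (ZMod p) U)} {v : V (ZMod p) U} (hv : v ∈ X)
    (a : U) : phi (ZMod p) a v ∈ upStar (phi (ZMod p) : U → _) X :=
  Submodule.subset_span (Set.mem_iUnion.2 ⟨a, v, hv, rfl⟩)

theorem mem_downStar {Y : Submodule (ZMod p) (W (ZMod p) U)} {v : V (ZMod p) U} :
    v ∈ downStar (phi (ZMod p) : U → _) Y ↔ ∀ a, phi (ZMod p) a v ∈ Y := by
  simp [downStar]

theorem le_downStar_upStar (X : Submodule (ZMod p) (V (ZMod p) U)) :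
    X ≤ downStar (phi (ZMod p) : U → _) (upStar (phi (ZMod p) : U → _) X) :=
  fun _ hv => mem_downStar.2 (phi_mem_upStar hv)

variable {θ : Multiplicative (V (ZMod p) U × W (ZMod p) U) →* F p n}
  (hθ : IsCommutatorHom u (gen p) θ)

/-- Since `X = N ⊓ C` and `θ(V) = C`, the subspace is the preimage of `N` itself, and `X` disappears
from the argument. -/
theorem toSubspace_eq (hp2 : p ≠ 2)
    {e : Multiplicative (V (ZMod p) U × W (ZMod p) U) ≃* lowerCentral 2 (F p n)}
    (he : IsIdentification u e) (hθ : IsCommutatorHom u (gen p) θ) {N X : Subgroup (F p n)}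
    (hX : IsRelationSubgroup N X) :
    toSubspace e X = comapSubmodule p (θ.comp (inlHom p U)) N := by
  ext v
  change (e (.ofAdd (v, 0)) : F p n) ∈ X ↔ θ (.ofAdd (v, 0)) ∈ N
  rw [he.coe_eq hθ, hX.eq_inf hp2, Subgroup.mem_inf, ← range_inl_eq_C hθ]
  exact and_iff_left ⟨.ofAdd v, rfl⟩

include hg hθ in
theorem isCapable_of_isClosedFor (hp2 : p ≠ 2) (hcyc : ¬ IsCyclic G)
    (hX : IsClosedFor (phi (ZMod p) : U → _)
      (comapSubmodule p (θ.comp (inlHom p U)) (psi hclass hexp g).ker)) : IsCapable G := by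
  set ψ := psi hclass hexp g with hψ
  set X := comapSubmodule p (θ.comp (inlHom p U)) ψ.ker with hXdef
  have h3 : lowerCentral 3 (F p n) ≤ ψ.ker := lowerCentral_three_le_ker_psi hclass hexp
  have memX (v w) : θ (.ofAdd (v, w)) ∈ ψ.ker ↔ v ∈ X := by
    rw [apply_prod_eq, Subgroup.mul_mem_cancel_right _ (h3 (hθ.mem_three w))]
    rfl
  let Y := upStar (phi (ZMod p) : U → _) X
  let N : Subgroup (F p n) := (AddSubgroup.toSubgroup Y.toAddSubgroup).map (θ.comp (inrHom p U))
  have hN3 : N ≤ lowerCentral 3 (F p n) := by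
    rintro _ ⟨w, -, rfl⟩
    exact hθ.mem_three _
  have memN (w) : θ (.ofAdd (0, w)) ∈ N ↔ w ∈ Y := by
    constructor
    · rintro ⟨w', hw', h⟩
      have h' := injective_of_isCommutatorHom_gen hp2 hθ h
      have : w' = w := congrArg (fun t => (Multiplicative.toAdd t).2) h'
      exact this ▸ hw'
    · exact fun hw => ⟨w, hw, rfl⟩
  have hNnormal : N.Normal :=
    normal_of_le_center (hN3.trans (lowerCentral_three_le_center lowerCentral_four_F))
  -- This identifies the centre of `F/N`. The forward direction is the only place where closedness
  -- is used.
  have key (f : F p n) : (∀ k, comm f (gen p k) ∈ N) ↔ f ∈ ψ.ker := by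
    constructor
    · intro h
      obtain ⟨v, w, rfl⟩ := exists_eq_of_mem_two hθ (mem_two_of_comm_mem_three hp2
        (exists_ne_of_not_isCyclic hclass hexp hg hcyc) fun k => hN3 (h k))
      simp only [hθ.comm_apply lowerCentral_four_F, memN] at h
      rw [memX, hX]
      exact mem_downStar.2 (phi_mem_of_basis h)
    · intro h k
      obtain ⟨v, w, rfl⟩ := exists_eq_of_mem_two hθ (ker_psi_le hclass hexp hg h)
      rw [hθ.comm_apply lowerCentral_four_F, memN]
      exact phi_mem_upStar ((memX v w).1 h) _
  refine isCapable_of_surjective (QuotientGroup.lift N ψ (hN3.trans h3))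
    (QuotientGroup.lift_surjective_of_surjective _ _ (psi_surjective hclass hexp hg) _) ?_
  ext f
  obtain ⟨f, rfl⟩ := QuotientGroup.mk'_surjective N f
  have h1 : QuotientGroup.mk' N f ∈ (QuotientGroup.lift N ψ (hN3.trans h3)).ker ↔ f ∈ ψ.ker :=
    Iff.rfl
  have hk (k) : comm f (gen p k) ∈ N ↔
      Commute (QuotientGroup.mk' N f) (QuotientGroup.mk' N (gen p k)) := by
    rw [← comm_eq_one_iff, ← map_comm]
    exact (QuotientGroup.eq_one_iff _).symm
  have hgen : Subgroup.closure (Set.range (QuotientGroup.mk' N ∘ gen p)) = ⊤ := by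
    rw [Set.range_comp, ← MonoidHom.map_closure, closure_range_gen,
      Subgroup.map_top_of_surjective _ (QuotientGroup.mk'_surjective _)]
  rw [h1, ← key, Subgroup.mem_center_iff]
  simp only [hk]
  exact ⟨fun h y => (commute_of_forall_commute_gen hgen h y).symm.eq, fun h k => (h _).symm⟩

include hg hθ in
theorem isClosedFor_of_isCapable (hp2 : p ≠ 2) (hG : IsCapable G) :
    IsClosedFor (phi (ZMod p) : U → _)
      (comapSubmodule p (θ.comp (inlHom p U)) (psi hclass hexp g).ker) := by
  obtain ⟨H, _, q, hq, hker⟩ := hG.exists_surjective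
  have hH3 : lowerCentral 3 H ≤ Subgroup.center H := by
    rw [← hker, ← Subgroup.map_eq_bot_iff, Subgroup.map_lowerCentralSeries, eq_bot_iff, ← hclass]
    exact Subgroup.lowerCentralSeries_mono _ le_top
  have hH : lowerCentral 4 H = ⊥ := Subgroup.commutator_top_right_eq_bot_iff_le_center.2 hH3
  choose h hh using fun i => hq (g i)
  have hcen (y : H) : y ∈ Subgroup.center H ↔ q y = 1 := by rw [← hker, MonoidHom.mem_ker]
  obtain ⟨η, hη⟩ := exists_isCommutatorHom u hp2 hH h fun i j => by
    have : h i ^ p ∈ Subgroup.center H := by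
      rw [hcen, map_pow, ← hexp, Monoid.pow_exponent_eq_one]
    exact (Subgroup.mem_center_iff.1 this (h j)).symm
  set ψ := psi hclass hexp g
  -- Both sides are commutator homomorphisms for the same family `g`, hence equal.
  have hcomp (t) : q (η t) = ψ (θ t) := by
    have h1 := hη.map q
    have h2 := hθ.map ψ
    rw [show q ∘ h = g from funext hh] at h1
    rw [show ψ ∘ gen p = g from funext (psi_gen hclass hexp g)] at h2
    exact DFunLike.congr_fun (h1.ext h2) t
  set X := comapSubmodule p (θ.comp (inlHom p U)) ψ.ker
  have memX (v) : v ∈ X ↔ η (.ofAdd (v, 0)) ∈ Subgroup.center H := by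
    rw [hcen, hcomp]
    rfl
  have hstar : upStar (phi (ZMod p) : U → _) X ≤ comapSubmodule p (η.comp (inrHom p U)) ⊥ := by
    rw [upStar, Submodule.span_le]
    intro w hw
    obtain ⟨a, v, hv, rfl⟩ := Set.mem_iUnion.1 hw
    refine phi_mem_of_basis (u := u) (fun k => ?_) a
    change η (.ofAdd (0, phi (ZMod p) (u k) v)) = 1
    rw [hη.phi, comm_eq_one_iff]
    exact (Subgroup.mem_center_iff.1 ((memX v).1 hv) (h k)).symm
  refine le_antisymm (le_downStar_upStar X) fun v hv => ?_
  rw [mem_downStar] at hv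
  have hv' (k) : Commute (η (.ofAdd (v, 0))) (h k) := by
    rw [← comm_eq_one_iff, ← hη.phi]
    exact hstar (hv (u k))
  rw [memX, Subgroup.mem_center_iff]
  intro y
  -- The `h_k` generate `H` modulo its centre, so `y` differs by a central factor from an element
  -- `y'` commuting with `η(v, 0)`.
  have hy : q y ∈ Subgroup.map q (Subgroup.centralizer {η (.ofAdd (v, 0))}) :=
    mem_of_closure_eq_top (closure_range_eq_top_of_projectsToBasis hclass hexp hg)
      (S := Subgroup.map q (Subgroup.centralizer {η (.ofAdd (v, 0))}))
      (fun k => ⟨h k, Subgroup.mem_centralizer_singleton_iff.2 (hv' k).symm.eq, hh k⟩) (q y)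
  obtain ⟨y', hy', hyy'⟩ := hy
  have hz : y'⁻¹ * y ∈ Subgroup.center H := by rw [hcen, map_mul, map_inv, hyy', inv_mul_cancel]
  have hz' := Subgroup.mem_center_iff.1 hz (η (.ofAdd (v, 0)))
  have hy'' : Commute y' (η (.ofAdd (v, 0))) := Subgroup.mem_centralizer_singleton_iff.1 hy'
  have := hy''.mul_left hz'.symm
  rw [mul_inv_cancel_left] at this
  exact this.eq

end Capable

end CapableGroups

open CapableGroups in
theorem mainTheorem1 {p : ℕ} [Fact p.Prime] (hp : p ≠ 2) {n : ℕ}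
    {U : Type*} [AddCommGroup U] [Module (ZMod p) U] (u : Module.Basis (Fin n) (ZMod p) U)
    {G : Type*} [Group G] (hcyc : ¬ IsCyclic G) (hclass : lowerCentral 3 G = ⊥)
    (hexp : Monoid.exponent G = p) (g : Fin n → G) (hg : ProjectsToBasis hexp g) :
    (∃! e, IsIdentification u e) ∧
    (∃! X, IsRelationSubgroup (psi hclass hexp g).ker X) ∧
    ∀ e X, IsIdentification u e → IsRelationSubgroup (psi hclass hexp g).ker X →
      (IsCapable G ↔ IsClosedFor (phi (ZMod p) : U → _) (toSubspace e X)) := by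
  refine ⟨existsUnique_isIdentification u hp, existsUnique_isRelationSubgroup hp
    (lowerCentral_three_le_ker_psi hclass hexp) (ker_psi_le hclass hexp hg), fun e X he hX => ?_⟩
  obtain ⟨θ, hθ⟩ := exists_isCommutatorHom_F u hp
  rw [toSubspace_eq hp he hθ hX]
  exact ⟨isClosedFor_of_isCapable hclass hexp hg hθ hp,
    isCapable_of_isClosedFor hclass hexp hg hθ hp hcyc⟩
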